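/- **Setting.** Let $N\ge 2$ players have actions $x_i\in\mathbb R^{n_i}$, put $n=\sum_i n_i$, $x=(x_1,\dots,x_N)\in\mathbb R^n$, and let $J_i(x_i,x_{-i})$ be the cost of player $i$. The players communicate over an undirected connected graph with edge set $\mathcal E$ and symmetric weights $a_{ij}$, with $a_{ij}>0$ if $(i,j)\in\mathcal E$ and $a_{ij}=0$ otherwise; its weighted Laplacian has eigenvalues $0=\lambda_1<\lambda_2\le\dots\le\lambda_N$. *Assumption 1.* For each $i$ and each fixed $x_{-i}$, $J_i(\cdot,x_{-i})$ is continuously differentiable, strictly convex and radially unbounded on $\mathbb R^{n_i}$. *Assumption 2.* The map $F(x)=\mathrm{col}\{\nabla_iJ_i(x)\}_i$, where $\nabla_i$ is the gradient in $x_i$, satisfies $\langle F(x)-F(y),x-y\rangle\ge\mu\|x-y\|^2$ with $\mu>0$, and for each $i$ there are $\theta_i,\theta_{-i}\ge0$ such that $\nabla_iJ_i$ is $\theta_i$-Lipschitz in $x_i$ uniformly in $x_{-i}$ and $\theta_{-i}$-Lipschitz in $x_{-i}$ uniformly in $x_i$. Put $\theta=\max_i(\theta_i^2+\theta_{-i}^2)^{1/2}$.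 *Assumption 3.* The initial states (estimate vectors) $\boldsymbol x^i(0)\in\mathbb R^n$ of all players satisfy $\|\boldsymbol x^i(0)\|_\infty\le M$, and every Nash equilibrium $x^*$ satisfies $\|x^*\|_\infty\le M'$, where $M_0:=M+M'>0$. **Dynamics.** Let $q$ be the uniform quantizer with levels $-L,\dots,L$: $q(x)=0$ for $|x|<\frac12$, $q(x)=i$ for $\frac{2i-1}2\le x<\frac{2i+1}2$, $1\le i\le L$, $q(x)=L$ for $x\ge\frac{2L+1}2$, $q(x)=-q(-x)$ for $x\le-\frac12$; let $Q$ apply $q$ to each of the $n$ coordinates. With sampling period $T$ and scaling $s(k)=s(0)e^{-\gamma kT}$, player $j$ sends to its neighbours at time $kT$ the message $\mathbf q^j(0)=Q(\boldsymbol x^j(0)/s(0))$, $\mathbf q^j(k)=Q\big((\boldsymbol x^j(kT)-\widehat{\boldsymbol x}^j((k-1)T))/s(k)\big)$ for $k\ge1$, which costs $n\log_2(2L+1)$ bits. The decoded values are $\widehat{\boldsymbol x}^j(0)=s(0)\mathbf q^j(0)$, $\widehat{\boldsymbol x}^j(kT)=\widehat{\boldsymbol x}^j((k-1)T)+s(k)\mathbf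 q^j(k)$, held constant on $[kT,(k+1)T)$. The players follow $$\dot{\boldsymbol x}^i(t)=\alpha\sum_{j=1}^Na_{ij}\big(\widehat{\boldsymbol x}^j(t)-\widehat{\boldsymbol x}^i(t)\big)-R_i\nabla_iJ_i(\boldsymbol x^i(t)),$$ where $R_iv\in\mathbb R^n$ has $i$-th block $\varepsilon v$ and all other blocks zero. **Design rules.** A design $(\varepsilon,\alpha,\beta,a_1,a_2,T,L)$ is admissible if $\varepsilon,T>0$, $\beta,a_1\in(0,1)$, $0<a_2<1-a_1$, $\alpha>\frac{\varepsilon}{\lambda_2}\big(\frac{\theta^2}\mu+\theta\big)$, $L$ is a positive integer, and, with $$\nu=2\lambda_{\min}\begin{pmatrix}\frac\mu N&-\frac\theta{\sqrt N}\\-\frac\theta{\sqrt N}&\frac{\alpha\lambda_2}\varepsilon-\theta\end{pmatrix},\qquad \gamma=\frac{\varepsilon\nu\beta}4,\qquad \rho=\Big(\frac{\theta\varepsilon}{\alpha\lambda_N}+1\Big)\frac{8\alpha\lambda_N}{\nu^2\beta\varepsilon\sqrt{1-\beta}},$$ $$s(0)=\frac{a_2\varepsilon\nu M_0}{\alpha\lambda_N}\sqrt{1-\beta}\,e^{-\gamma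 T-\alpha\lambda_NT},$$ one has $(e^{\alpha\lambda_NT}-1)(e^{\gamma T}-1)\rho\varepsilon^{-1}\le a_1$ and $L\ge\max\Big\{\frac{M_0}{s(0)},\Big\lceil\frac{\sqrt{Nn}\,e^{\gamma T+\alpha\lambda_NT}}{2a_2}-\frac12\Big\rceil\Big\}$. The number $\gamma$ is the convergence rate of the design. Its bandwidth is $$\mathcal B=\max_{(j,i)\in\mathcal E}\ \limsup_{t\to\infty}\frac1t\sum_{k:\,kT\le t}r_{ji}(k),\qquad r_{ji}(k)=n\log_2(2L+1).$$ The minimum bandwidth required for rate $\gamma$ is the infimum of the bandwidths of all admissible designs of rate $\gamma$ with which the dynamics converges exponentially at rate $\gamma$ to a Nash equilibrium; that is, for all initial states allowed by Assumption 3 a solution exists on $[0,\infty)$, and there are a Nash equilibrium $x^*$ and a constant $C$ such that every such solution satisfies $\|\boldsymbol x(t)-1_N\otimes x^*\|\le Ce^{-\gamma t}$ for all $t\ge0$. **Theorem 3.** Under Assumptions 1 and 2 there are constants $c_1,c_2>0$, depending only on the game and the graph (not on $\mathcal B$, $\gamma$, $M$, $M'$), such that, under Assumption 3, for every $\gamma>0$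 there is an admissible design of rate $\gamma$ with which the dynamics converges exponentially at rate $\gamma$ to a Nash equilibrium and whose bandwidth is at most $c_1\gamma+c_2$. In particular the minimum bandwidth $\mathcal B$ required for rate $\gamma$ satisfies $$\mathcal B\le c_1\gamma+c_2 .$$ -/

import Mathlib

noncomputable section

open Filter Topology

namespace QuantizedNash

/-! ### Communication graph -/

/-- An undirected weighted graph on `N` vertices: an edge set together with a symmetric
adjacency matrix `[a i j]`, positive exactly on the edges and zero elsewhere. -/
structure CommGraph (N : ℕ) where
  graph : SimpleGraph (Fin N)
  weight : Fin N → Fin N → ℝ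
  symm : ∀ i j, weight i j = weight j i
  pos : ∀ i j, graph.Adj i j → 0 < weight i j
  zero : ∀ i j, ¬ graph.Adj i j → weight i j = 0

/-- The weighted Laplacian. -/
def CommGraph.laplacian {N : ℕ} (W : CommGraph N) : Matrix (Fin N) (Fin N) ℝ :=
  Matrix.of fun i j => if i = j then ∑ k ∈ Finset.univ.erase i, W.weight i k else -W.weight i j

theorem CommGraph.laplacian_isHermitian {N : ℕ} (W : CommGraph N) :
    W.laplacian.IsHermitian := by
  ext i j
  by_cases h : i = j
  · subst h
    simp [CommGraph.laplacian]
  · have h' : j ≠ i := fun e => h e.symm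
    simp [CommGraph.laplacian, h, h', W.symm i j]

/-- The eigenvalues, with multiplicity, of a real symmetric matrix in ascending order
(Mathlib's `eigenvalues₀` lists them in descending order); the index starts at `0`. -/
def ascEig {m : ℕ} {A : Matrix (Fin m) (Fin m) ℝ} (hA : A.IsHermitian) (k : Fin m) : ℝ :=
  hA.eigenvalues₀ (Fin.cast (Fintype.card_fin m).symm k.rev)

/-- `λ₂`, the second smallest Laplacian eigenvalue. -/
def CommGraph.lam2 {N : ℕ} (W : CommGraph N) (hN : 2 ≤ N) : ℝ :=
  ascEig W.laplacian_isHermitian ⟨1, by omega⟩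

/-- `λ_N`, the largest Laplacian eigenvalue. -/
def CommGraph.lamN {N : ℕ} (W : CommGraph N) (hN : 2 ≤ N) : ℝ :=
  ascEig W.laplacian_isHermitian ⟨N - 1, by omega⟩

/-! ### The game -/

/-- Action profiles `x = (x_1, …, x_N)`, `x_i ∈ ℝ^{n_i}`, with the Euclidean norm; this is `ℝⁿ`
with `n = ∑ n_i`. -/
abbrev Profile {N : ℕ} (d : Fin N → ℕ) : Type :=
  PiLp 2 fun i : Fin N => EuclideanSpace ℝ (Fin (d i))

/-- Stacked estimates `(𝒙^1, …, 𝒙^N)`, one profile for each player, with the Euclidean norm. -/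
abbrev Stack {N : ℕ} (d : Fin N → ℕ) : Type :=
  PiLp 2 fun _ : Fin N => Profile d

variable {N : ℕ} {d : Fin N → ℕ}

/-- The profile `(z, x_{-i})`. -/
def replaceAction (x : Profile d) (i : Fin N) (z : EuclideanSpace ℝ (Fin (d i))) : Profile d :=
  WithLp.toLp 2 (Function.update (WithLp.ofLp x) i z)

/-- `‖x‖_∞ ≤ M`. -/
def SupBound (x : Profile d) (M : ℝ) : Prop :=
  ∀ (i : Fin N) (c : Fin (d i)), |x i c| ≤ M

/-- Nash equilibria: no player can lower its own cost by a unilateral change of action. -/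
def IsNash (J : Fin N → Profile d → ℝ) (x : Profile d) : Prop :=
  ∀ (i : Fin N) (z : EuclideanSpace ℝ (Fin (d i))), J i x ≤ J i (replaceAction x i z)

/-- The partial gradient `∇_i J_i (x_i, x_{-i})` with respect to the player's own action. -/
def ownGrad (J : Fin N → Profile d → ℝ) (i : Fin N) (x : Profile d) :
    EuclideanSpace ℝ (Fin (d i)) :=
  gradient (fun z => J i (replaceAction x i z)) (x i)

/-- The game mapping `F(x) = col{∇_i J_i(x)}`. -/
def gameMap (J : Fin N → Profile d → ℝ) (x : Profile d) : Profile d :=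
  WithLp.toLp 2 fun i => ownGrad J i x

/-- Each `J_i(·, x_{-i})` is continuously differentiable, strictly convex and radially
unbounded. -/
structure RegularCosts (J : Fin N → Profile d → ℝ) : Prop where
  contDiff : ∀ i x, ContDiff ℝ 1 fun z => J i (replaceAction x i z)
  strictConvex : ∀ i x, StrictConvexOn ℝ Set.univ fun z => J i (replaceAction x i z)
  unbounded : ∀ i x, Tendsto (fun z => J i (replaceAction x i z)) (Bornology.cobounded _) atTop

/-- The game mapping is `μ`-strongly monotone, and `∇_i J_i` is `θ_i`-Lipschitz in `x_i` and
`θ_{-i}`-Lipschitz in `x_{-i}`, uniformly in the other variable. -/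
structure MonotoneLipschitz (J : Fin N → Profile d → ℝ) (μ : ℝ) (θown θother : Fin N → ℝ) :
    Prop where
  mu_pos : 0 < μ
  own_nonneg : ∀ i, 0 ≤ θown i
  other_nonneg : ∀ i, 0 ≤ θother i
  strongMono : ∀ x y : Profile d, μ * ‖x - y‖ ^ 2 ≤ inner ℝ (gameMap J x - gameMap J y) (x - y)
  lip_own : ∀ (i : Fin N) (x y : Profile d), (∀ j, j ≠ i → x j = y j) →
    ‖ownGrad J i x - ownGrad J i y‖ ≤ θown i * ‖x i - y i‖
  lip_other : ∀ (i : Fin N) (x y : Profile d), x i = y i →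
    ‖ownGrad J i x - ownGrad J i y‖ ≤ θother i * ‖x - y‖

/-- `θ`, the largest of the numbers `(θ_i² + θ_{-i}²)^{1/2}`. -/
def theta (θown θother : Fin N → ℝ) : ℝ :=
  ⨆ i, Real.sqrt (θown i ^ 2 + θother i ^ 2)

/-! ### Quantizer, encoder and decoder -/

/-- The uniform quantizer with values in `{-L, …, L}`: rounding to a nearest integer (ties away
from zero), saturated at `±L`. -/
def quantize (L : ℕ) (x : ℝ) : ℤ :=
  if x ≤ -(1 / 2) then -min (L : ℤ) ⌊-x + 1 / 2⌋ else min (L : ℤ) ⌊x + 1 / 2⌋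

/-- The componentwise quantizer on `ℝⁿ`. -/
def quantizeVec (L : ℕ) (x : Profile d) : Profile d :=
  WithLp.toLp 2 fun i => WithLp.toLp 2 fun c => (quantize L (x i c) : ℝ)

/-- The decoded value after `k` steps, for the scaling `s` and the samples `y k` of one player:
the message is `q(0) = Q(y(0)/s(0))` and `q(k+1) = Q((y(k+1) - ŷ(k))/s(k+1))`, the decoder is
`ŷ(0) = s(0) q(0)` and `ŷ(k+1) = ŷ(k) + s(k+1) q(k+1)`. -/
def decode (L : ℕ) (s : ℕ → ℝ) (y : ℕ → Profile d) : ℕ → Profile d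
  | 0 => s 0 • quantizeVec L ((s 0)⁻¹ • y 0)
  | k + 1 => decode L s y k +
      s (k + 1) • quantizeVec L ((s (k + 1))⁻¹ • (y (k + 1) - decode L s y k))

/-! ### Parameters -/

/-- The numbers through which the parameter design depends on the game and the graph: the number
of players, the dimension `n`, `λ₂`, `λ_N`, `μ`, `θ` and `M₀`. -/
structure Consts where
  N : ℕ
  n : ℕ
  lam2 : ℝ
  lamN : ℝ
  μ : ℝ
  θ : ℝ
  M0 : ℝ

/-- The free parameters of the algorithm. -/
structure Design where
  ε : ℝ
  α : ℝ
  β : ℝ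
  a1 : ℝ
  a2 : ℝ
  T : ℝ
  L : ℕ

/-- The symmetric `2 × 2` matrix whose smallest eigenvalue is `ν / 2`. -/
def rateMatrix (c : Consts) (p : Design) : Matrix (Fin 2) (Fin 2) ℝ :=
  !![c.μ / c.N, -(c.θ / Real.sqrt c.N);
     -(c.θ / Real.sqrt c.N), p.α * c.lam2 / p.ε - c.θ]

theorem rateMatrix_isHermitian (c : Consts) (p : Design) : (rateMatrix c p).IsHermitian := by
  ext i j
  fin_cases i <;> fin_cases j <;> simp [rateMatrix]

def nu (c : Consts) (p : Design) : ℝ := 2 * ascEig (rateMatrix_isHermitian c p) 0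

/-- The convergence rate `γ = ενβ/4` of a design. -/
def rate (c : Consts) (p : Design) : ℝ := p.ε * nu c p * p.β / 4

def rho (c : Consts) (p : Design) : ℝ :=
  (c.θ * p.ε / (p.α * c.lamN) + 1) *
    (8 * p.α * c.lamN / (nu c p ^ 2 * p.β * p.ε * Real.sqrt (1 - p.β)))

def s0 (c : Consts) (p : Design) : ℝ :=
  p.a2 * p.ε * nu c p * c.M0 / (p.α * c.lamN) * Real.sqrt (1 - p.β) *
    Real.exp (-rate c p * p.T - p.α * c.lamN * p.T)

/-- The scaling function `s(k) = s(0) e^{-γkT}`. -/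
def scaling (c : Consts) (p : Design) (k : ℕ) : ℝ :=
  s0 c p * Real.exp (-rate c p * k * p.T)

/-- The design rules for the parameters. -/
structure Admissible (c : Consts) (p : Design) : Prop where
  eps_pos : 0 < p.ε
  gain : p.ε / c.lam2 * (c.θ ^ 2 / c.μ + c.θ) < p.α
  beta_pos : 0 < p.β
  beta_lt : p.β < 1
  a1_pos : 0 < p.a1
  a1_lt : p.a1 < 1
  a2_pos : 0 < p.a2
  a2_lt : p.a2 < 1 - p.a1
  period_pos : 0 < p.T
  period : (Real.exp (p.α * c.lamN * p.T) - 1) * (Real.exp (rate c p * p.T) - 1) *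
    rho c p * p.ε⁻¹ ≤ p.a1
  level_pos : 0 < p.L
  level_init : c.M0 / s0 c p ≤ p.L
  level : ⌈Real.sqrt (c.N * c.n) * Real.exp (rate c p * p.T + p.α * c.lamN * p.T) / (2 * p.a2)
    - 1 / 2⌉ ≤ (p.L : ℤ)

/-! ### The closed loop -/

/-- `𝒙̂^i(t)`: the last decoded value, held constant between the sampling instants `kT`. -/
def estimate (c : Consts) (p : Design) (x : ℝ → Stack d) (i : Fin N) (t : ℝ) : Profile d :=
  decode p.L (scaling c p) (fun k => x (k * p.T) i) ⌊t / p.T⌋₊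

/-- The right-hand side
`α ∑_j a_ij (𝒙̂^j(t) - 𝒙̂^i(t)) - R_i ∇_i J_i(𝒙^i(t))`, `i = 1, …, N`, where `R_i v` is the profile
with `i`-th block `ε v` and all other blocks zero. -/
def velocity (W : CommGraph N) (J : Fin N → Profile d → ℝ) (c : Consts) (p : Design)
    (x : ℝ → Stack d) (t : ℝ) : Stack d :=
  WithLp.toLp 2 fun i =>
    p.α • ∑ j, W.weight i j • (estimate c p x j t - estimate c p x i t) -
      WithLp.toLp 2 (Pi.single i (p.ε • ownGrad J i (x t i)))

/-- Solutions on `[0, ∞)`. The right-hand side jumps at the sampling instants, so a solution is a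
continuous curve that satisfies the equation at every time with the right derivative. -/
def IsSolution (W : CommGraph N) (J : Fin N → Profile d → ℝ) (c : Consts) (p : Design)
    (x : ℝ → Stack d) : Prop :=
  ContinuousOn x (Set.Ici 0) ∧
    ∀ t, 0 ≤ t → HasDerivWithinAt x (velocity W J c p x t) (Set.Ici t) t

/-- For all initial states bounded by `M` the closed loop has a solution, and all these solutions
converge to one and the same Nash equilibrium with exponential rate `γ`. -/
def ConvergesToNash (W : CommGraph N) (J : Fin N → Profile d → ℝ) (c : Consts) (p : Design)
    (M γ : ℝ) : Prop :=
  (∀ z : Stack d, (∀ i, SupBound (z i) M) → ∃ x, IsSolution W J c p x ∧ x 0 = z) ∧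
  ∃ xs : Profile d, IsNash J xs ∧ ∃ C : ℝ, ∀ x : ℝ → Stack d, IsSolution W J c p x →
    (∀ i, SupBound (x 0 i) M) →
      ∀ t, 0 ≤ t → ‖x t - WithLp.toLp 2 (fun _ => xs)‖ ≤ C * Real.exp (-γ * t)

/-! ### Bandwidth -/

/-- `max_{(j,i) ∈ E} limsup_{t → ∞} (1/t) ∑_{kT ≤ t} r_{ji}(k)`, in bits per unit of time. -/
def bandwidth (W : CommGraph N) (T : ℝ) (r : Fin N → Fin N → ℕ → ℝ) : ℝ :=
  ⨆ e : {e : Fin N × Fin N // W.graph.Adj e.1 e.2},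
    limsup (fun t : ℝ => 1 / t * ∑ k ∈ Finset.range (⌊t / T⌋₊ + 1), r e.1.1 e.1.2 k) atTop

/-- The bandwidth of a design: every message is one value of the quantizer on `ℝⁿ`, that is
`n log₂ (2L + 1)` bits. -/
def designBandwidth (W : CommGraph N) (c : Consts) (p : Design) : ℝ :=
  bandwidth W p.T fun _ _ _ => (c.n : ℝ) * Real.logb 2 (2 * (p.L : ℝ) + 1)

/-- The constants attached to a game and a graph. -/
def consts (W : CommGraph N) (hN : 2 ≤ N) (d : Fin N → ℕ) (μ : ℝ) (θown θother : Fin N → ℝ)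
    (M M' : ℝ) : Consts where
  N := N
  n := ∑ i, d i
  lam2 := W.lam2 hN
  lamN := W.lamN hN
  μ := μ
  θ := theta θown θother
  M0 := M + M'

/-- The bandwidths with which convergence rate `γ` is achieved: those of the admissible designs
of rate `γ` for which the closed loop converges to a Nash equilibrium with this rate. -/
def sufficientBandwidths (W : CommGraph N) (J : Fin N → Profile d → ℝ) (c : Consts) (M γ : ℝ) :
    Set ℝ :=
  {B | ∃ p : Design, Admissible c p ∧ rate c p = γ ∧ ConvergesToNash W J c p M γ ∧
    B = designBandwidth W c p}

/-- The minimum bandwidth required for convergence rate `γ`. -/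
def minBandwidth (W : CommGraph N) (J : Fin N → Profile d → ℝ) (c : Consts) (M γ : ℝ) : ℝ :=
  sInf (sufficientBandwidths W J c M γ)

end QuantizedNash

end

open QuantizedNash

noncomputable section

open Filter Topology
open scoped NNReal

namespace QuantizedNash

variable {N : ℕ} {d : Fin N → ℕ}

/-! The design can be made to scale with the rate. Put α = κε with κ fixed by the game and the
graph. Then ν depends only on κ (`exists_nu_eq`), and for fixed β the rule γ = ενβ/4 forces ε = χγ
with a constant χ. With T = τ/(γ+1) the products γT, εT and αT stay below constants, and s(0) is
comparable to M₀, so one L serves all γ and all M₀ (`exists_uniform_design`). The bandwidth n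
log₂(2L+1)(γ+1)/τ is affine in γ.

Convergence rests on coercivity. The game map has a zero by strong monotonicity, and by convexity
this zero is an equilibrium. For large κ the consensus term makes the stacked dynamics coercive
around it (`MonotoneLipschitz.exists_augmented_coercive`): the Poincaré inequality of the connected
graph controls the disagreement of the estimates, strong monotonicity their common part. With exact
communication the decay rate would be 2γ; asking only for γ leaves a margin that pays for held,
quantized values. `norm_le_of_held_feedback` does this over one period, and
`norm_sub_le_of_isSolution` iterates it: the prediction error decays like the scaling, so the
quantizer never saturates and each message restores the small decoding error. Solutions exist
because each period is a Lipschitz initial value problem (`exists_isSolution`). -/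

/-! ### Differential equations in a Hilbert space -/

/-- A Lipschitz autonomous equation is solvable on an interval of length `h` if `K h ≤ 1 / 2`. -/
theorem exists_solution_of_lipschitz {H : Type*} [NormedAddCommGroup H] [NormedSpace ℝ H]
    [CompleteSpace H] {f : H → H} {K : ℝ≥0} (hf : LipschitzWith K f) {h : ℝ} (hh : 0 ≤ h)
    (hK : K * h ≤ 1 / 2) (x₀ : H) :
    ∃ X : ℝ → H, X 0 = x₀ ∧ ∀ t ∈ Set.Icc 0 h, HasDerivWithinAt X (f (X t)) (Set.Icc 0 h) t := by
  -- The ball radius must satisfy h(KA + ‖f x₀‖) ≤ A; since Kh ≤ 1/2, twice h‖f x₀‖ is enough.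
  set A : ℝ≥0 := ⟨2 * h * ‖f x₀‖, by positivity⟩ with hA
  have hAv : (A : ℝ) = 2 * h * ‖f x₀‖ := rfl
  have hp : IsPicardLindelof (fun _ => f) (⟨0, by simp [hh]⟩ : Set.Icc (0 : ℝ) h) x₀ A 0
      (K * A + ‖f x₀‖₊) K := by
    refine ⟨fun t _ => hf.lipschitzOnWith, fun x _ => continuousOn_const, fun t _ x hx => ?_, ?_⟩
    · have h1 := hf.dist_le_mul x x₀
      rw [dist_eq_norm] at h1
      have h2 : ‖f x‖ ≤ ‖f x - f x₀‖ + ‖f x₀‖ := norm_le_norm_sub_add _ _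
      have h3 : dist x x₀ ≤ A := hx
      have h4 : (K : ℝ) * dist x x₀ ≤ K * A := by gcongr
      push_cast
      linarith
    · simp only [sub_zero, NNReal.coe_add, NNReal.coe_mul, coe_nnnorm, NNReal.coe_zero]
      rw [max_eq_left (by simpa using hh), hAv]
      have h5 : (K * h) * (2 * h * ‖f x₀‖) ≤ 1 / 2 * (2 * h * ‖f x₀‖) := by gcongr
      nlinarith
  obtain ⟨X, h0, hX⟩ := hp.exists_eq_forall_mem_Icc_hasDerivWithinAt₀
  exact ⟨X, h0, hX⟩

/-- Between two sampling instants `a` and `b` the bounds `Y e^{-γt}` on the state and `E e^{-γt}` on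
its distance from the held value `h` are maintained. -/
theorem norm_le_of_held_feedback {H : Type*} [NormedAddCommGroup H] [InnerProductSpace ℝ H]
    {A : H →L[ℝ] H} {y r : ℝ → H} {h : H} {a b γ K Γ Y q E : ℝ}
    (hy : ContinuousOn y (Set.Icc a b))
    (hy' : ∀ t ∈ Set.Ico a b, HasDerivWithinAt y (-A h - r t) (Set.Ici t) t)
    (hr : ∀ t, ‖r t‖ ≤ K * ‖y t‖) (hA : ∀ v, ‖A v‖ ≤ Γ * ‖v‖)
    (hdiss : ∀ t, 2 * γ * ‖y t‖ ^ 2 ≤ inner ℝ (y t) (A (y t)) + inner ℝ (y t) (r t))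
    (hab : a ≤ b) (hγ : 0 < γ) (hK0 : 0 ≤ K) (hΓ : 0 < Γ) (hY : 0 < Y) (hq : 0 ≤ q)
    (hK : K * (b - a) ≤ 1 / 4)
    (hE : (q + 2 * (Γ * (Y + q) + K * Y) * (b - a)) * Real.exp (γ * (b - a)) ≤ E)
    (hEY : Γ * E < γ * Y)
    (hya : ‖y a‖ ≤ Y * Real.exp (-γ * a)) (hha : ‖h - y a‖ ≤ q * Real.exp (-γ * a)) :
    ∀ t ∈ Set.Icc a b, ‖y t‖ ≤ Y * Real.exp (-γ * t) ∧ ‖h - y t‖ ≤ E * Real.exp (-γ * t) := by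
  set D := Real.exp (-γ * a) with hD
  have hDpos : 0 < D := Real.exp_pos _
  set c := Γ * (Y + q) + K * Y with hc
  have hcpos : 0 < c := by positivity
  have hh : ‖h‖ ≤ (Y + q) * D := by
    have := norm_le_norm_sub_add h (y a)
    linarith
  -- Bootstrap: where the drift touches its bound, K(b - a) ≤ 1/4 keeps the speed below (3/2)cD,
  -- strictly less than the slope 2cD of the bound.
  have hdrift : ∀ t ∈ Set.Icc a b, ‖y t - y a‖ ≤ 2 * (c * D) * (t - a) := by
    refine image_norm_le_of_norm_deriv_right_lt_deriv_boundary
      (f := fun t => y t - y a) (f' := fun t => -A h - r t)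
      (B := fun t => 2 * (c * D) * (t - a)) (B' := fun _ => 2 * (c * D)) (hy.sub continuousOn_const)
      (fun t ht => (hy' t ht).sub_const _) (by simp) (fun t => ?_) ?_
    · simpa using ((hasDerivAt_id t).sub_const a).const_mul (2 * (c * D))
    · intro t ht hB
      have h1 : ‖-A h - r t‖ ≤ ‖A h‖ + ‖r t‖ := by
        simpa using norm_sub_le (-A h) (r t)
      have h2 : ‖y t‖ ≤ ‖y t - y a‖ + ‖y a‖ := norm_le_norm_sub_add _ _
      have h3 : K * ‖y t‖ ≤ K * (2 * (c * D) * (t - a) + Y * D) := by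
        gcongr; linarith
      have h4 : Γ * ‖h‖ ≤ Γ * ((Y + q) * D) := by gcongr
      have h5 : K * (t - a) ≤ 1 / 4 := le_trans (by gcongr; exact ht.2.le) hK
      have h6 : (K * (t - a)) * (2 * (c * D)) ≤ 1 / 4 * (2 * (c * D)) := by gcongr
      have h7 : 0 < c * D := by positivity
      have h8 : c * D = Γ * ((Y + q) * D) + K * (Y * D) := by rw [hc]; ring
      have := hA h
      have := hr t
      nlinarith
  have hexp : ∀ t ∈ Set.Icc a b, D ≤ Real.exp (γ * (b - a)) * Real.exp (-γ * t) := by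
    intro t ht
    rw [← Real.exp_add, hD]
    apply Real.exp_le_exp.2
    nlinarith [mul_le_mul_of_nonneg_left ht.2 hγ.le]
  have herr : ∀ t ∈ Set.Icc a b, ‖h - y t‖ ≤ E * Real.exp (-γ * t) := by
    intro t ht
    have h1 : ‖h - y t‖ ≤ ‖h - y a‖ + ‖y t - y a‖ := by
      have := norm_sub_le (h - y a) (y t - y a)
      simpa using this
    have h2 := hdrift t ht
    have h3 : 2 * (c * D) * (t - a) ≤ 2 * (c * D) * (b - a) := by gcongr; exact ht.2
    have hba : 0 ≤ b - a := by linarith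
    calc ‖h - y t‖ ≤ (q + 2 * c * (b - a)) * D := by nlinarith
      _ ≤ (q + 2 * c * (b - a)) * (Real.exp (γ * (b - a)) * Real.exp (-γ * t)) := by
        gcongr; exact hexp t ht
      _ = (q + 2 * c * (b - a)) * Real.exp (γ * (b - a)) * Real.exp (-γ * t) := by ring
      _ ≤ E * Real.exp (-γ * t) := by gcongr
  -- Comparison for the squared norm. Where it touches the bound, coercivity gives the derivative
  -- -4γ‖y‖², and the held error gives back less than 2γ‖y‖² because ΓE < γY.
  have hstate : ∀ t ∈ Set.Icc a b, ‖y t‖ ^ 2 ≤ (Y * Real.exp (-γ * t)) ^ 2 := by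
    refine image_le_of_deriv_right_lt_deriv_boundary
      (f := fun t => ‖y t‖ ^ 2) (f' := fun t => 2 * inner ℝ (y t) (-A h - r t))
      (B := fun t => (Y * Real.exp (-γ * t)) ^ 2)
      (B' := fun t => -2 * γ * (Y * Real.exp (-γ * t)) ^ 2)
      (hy.norm.pow 2) (fun t ht => (hy' t ht).norm_sq) ?_ (fun t => ?_) ?_
    · exact pow_le_pow_left₀ (norm_nonneg _) hya 2
    · have h1 := ((((hasDerivAt_id t).const_mul (-γ)).exp).const_mul Y).pow 2
      refine h1.congr_deriv ?_
      simp
      ring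
    · intro t ht hB
      have hpos : 0 < Y * Real.exp (-γ * t) := by positivity
      have hyt : ‖y t‖ = Y * Real.exp (-γ * t) := by
        have := (pow_left_inj₀ (norm_nonneg (y t)) hpos.le two_ne_zero).1 hB
        exact this
      have h1 : inner ℝ (y t) (-A h - r t) =
          -(inner ℝ (y t) (A (y t)) + inner ℝ (y t) (r t)) - inner ℝ (y t) (A (h - y t)) := by
        rw [map_sub, inner_sub_right, inner_sub_right, inner_neg_right]; ring
      have h2 : -inner ℝ (y t) (A (h - y t)) ≤ ‖y t‖ * (Γ * (E * Real.exp (-γ * t))) := by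
        have h3 := (abs_le.1 (abs_real_inner_le_norm (y t) (A (h - y t)))).1
        have h4 : ‖A (h - y t)‖ ≤ Γ * (E * Real.exp (-γ * t)) :=
          (hA _).trans (by gcongr; exact herr t ⟨ht.1, ht.2.le⟩)
        have h5 : ‖y t‖ * ‖A (h - y t)‖ ≤ ‖y t‖ * (Γ * (E * Real.exp (-γ * t))) := by gcongr
        linarith
      have h3 := hdiss t
      have h4 : ‖y t‖ * (Γ * (E * Real.exp (-γ * t))) < ‖y t‖ * (γ * (Y * Real.exp (-γ * t))) := by
        have : 0 < ‖y t‖ := hyt ▸ hpos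
        have h5 : Γ * E * Real.exp (-γ * t) < γ * Y * Real.exp (-γ * t) := by
          gcongr
        nlinarith
      rw [h1]
      rw [← hyt] at h4 ⊢
      nlinarith
  intro t ht
  exact ⟨le_of_sq_le_sq (hstate t ht) (by positivity), herr t ht⟩

/-! ### The quantizer -/

/-- Rounding errs by at most 1/2, and saturation at L does no worse up to L + 1/2. The negative
branch follows from oddness, so `key` treats only arguments at least -1/2. -/
theorem abs_sub_quantize_le {L : ℕ} {x : ℝ} (hx : |x| ≤ L + 1 / 2) :
    |x - quantize L x| ≤ 1 / 2 := by
  have key : ∀ z : ℝ, -(1 / 2) ≤ z → z ≤ L + 1 / 2 →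
      |z - ((min (L : ℤ) ⌊z + 1 / 2⌋ : ℤ) : ℝ)| ≤ 1 / 2 := by
    intro z h1 h2
    have h3 := Int.floor_le (z + 1 / 2)
    have h4 := Int.lt_floor_add_one (z + 1 / 2)
    rcases le_total (L : ℤ) ⌊z + 1 / 2⌋ with h | h
    · rw [min_eq_left h]
      have h5 : (L : ℝ) ≤ ⌊z + 1 / 2⌋ := by exact_mod_cast h
      rw [abs_le]
      constructor <;> push_cast <;> linarith
    · rw [min_eq_right h, abs_le]
      constructor <;> linarith
  rw [abs_le] at hx
  unfold quantize
  split_ifs with h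
  · have := key (-x) (by linarith) (by linarith [hx.1])
    rw [abs_le] at this ⊢
    push_cast at this ⊢
    constructor <;> linarith [this.1, this.2]
  · exact key x (by linarith) hx.2

theorem norm_sub_smul_quantizeVec_le {L : ℕ} {s : ℝ} (hs : 0 < s) {v : Profile d}
    (hv : SupBound v (s * (L + 1 / 2))) :
    ‖v - s • quantizeVec L (s⁻¹ • v)‖ ^ 2 ≤ (∑ i, d i : ℕ) * (s / 2) ^ 2 := by
  rw [PiLp.norm_sq_eq_of_L2]
  have : ∀ i, ‖(v - s • quantizeVec L (s⁻¹ • v)) i‖ ^ 2 ≤ d i * (s / 2) ^ 2 := by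
    intro i
    rw [EuclideanSpace.norm_sq_eq]
    have hc : ∀ c ∈ Finset.univ, ‖((v - s • quantizeVec L (s⁻¹ • v)) i) c‖ ^ 2 ≤ (s / 2) ^ 2 := by
      intro c _
      refine pow_le_pow_left₀ (norm_nonneg _) ?_ 2
      have h1 : ((v - s • quantizeVec L (s⁻¹ • v)) i) c =
          s * (s⁻¹ * v i c - quantize L (s⁻¹ * v i c)) := by
        simp [quantizeVec]
        field_simp
      have h2 : |s⁻¹ * v i c| ≤ L + 1 / 2 := by
        rw [abs_mul, abs_of_pos (inv_pos.2 hs), inv_mul_le_iff₀ hs]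
        exact hv i c
      rw [h1, norm_mul, Real.norm_eq_abs, Real.norm_eq_abs, abs_of_pos hs]
      have := mul_le_mul_of_nonneg_left (abs_sub_quantize_le h2) hs.le
      linarith
    simpa using Finset.sum_le_sum hc
  refine (Finset.sum_le_sum fun i _ => this i).trans (le_of_eq ?_)
  rw [← Finset.sum_mul]
  push_cast
  rfl

theorem supBound_of_norm_le {v : Profile d} {b : ℝ} (h : ‖v‖ ≤ b) : SupBound v b := fun i c =>
  ((PiLp.norm_apply_le (v i) c).trans (PiLp.norm_apply_le v i)).trans h

/-! ### The graph Laplacian -/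

theorem ascEig_eq_eigenvalues {m : ℕ} {A : Matrix (Fin m) (Fin m) ℝ} (hA : A.IsHermitian)
    (k : Fin m) : ascEig hA k = hA.eigenvalues (Fintype.equivOfCardEq (Fintype.card_fin _)
      (Fin.cast (Fintype.card_fin m).symm k.rev)) := by
  simp [ascEig, Matrix.IsHermitian.eigenvalues]

theorem ascEig_mono {m : ℕ} {A : Matrix (Fin m) (Fin m) ℝ} (hA : A.IsHermitian) :
    Monotone (ascEig hA) := fun i j hij =>
  hA.eigenvalues₀_antitone (by
    rw [Fin.le_def] at hij ⊢
    simp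
    omega)

namespace CommGraph

variable (W : CommGraph N)

theorem weight_nonneg (i j : Fin N) : 0 ≤ W.weight i j := by
  by_cases h : W.graph.Adj i j
  · exact (W.pos i j h).le
  · exact (W.zero i j h).ge

/-- Twice the quadratic form of the Laplacian. -/
def energy {E : Type*} [NormedAddCommGroup E] (v : Fin N → E) : ℝ :=
  ∑ i, ∑ j, W.weight i j * ‖v i - v j‖ ^ 2

theorem energy_nonneg {E : Type*} [NormedAddCommGroup E] (v : Fin N → E) : 0 ≤ W.energy v :=
  Finset.sum_nonneg fun i _ => Finset.sum_nonneg fun j _ =>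
    mul_nonneg (W.weight_nonneg i j) (by positivity)

theorem sum_weight_inner_eq_energy {E : Type*} [NormedAddCommGroup E] [InnerProductSpace ℝ E]
    (v : Fin N → E) :
    ∑ i, ∑ j, W.weight i j * inner ℝ (v i) (v i - v j) = W.energy v / 2 := by
  have h : ∑ i, ∑ j, W.weight i j * inner ℝ (v i) (v i - v j) =
      ∑ i, ∑ j, W.weight i j * inner ℝ (v j) (v j - v i) := by
    rw [Finset.sum_comm]
    simp_rw [W.symm]
  have h2 : W.energy v = ∑ i, ∑ j, W.weight i j * inner ℝ (v i) (v i - v j) +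
      ∑ i, ∑ j, W.weight i j * inner ℝ (v j) (v j - v i) := by
    rw [energy, ← Finset.sum_add_distrib]
    refine Finset.sum_congr rfl fun i _ => ?_
    rw [← Finset.sum_add_distrib]
    refine Finset.sum_congr rfl fun j _ => ?_
    rw [← mul_add, ← real_inner_self_eq_norm_sq]
    simp only [inner_sub_left, inner_sub_right]
    ring
  rw [← h] at h2
  linarith

/-- Each edge of a walk has positive weight, so the energy bounds the difference across it; the
edges are added up by (a+b)² ≤ 2a² + 2b². The size of the constant is immaterial. -/
theorem exists_norm_sub_sq_le_of_reachable {E : Type*} [NormedAddCommGroup E] {i j : Fin N}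
    (h : W.graph.Reachable i j) :
    ∃ C : ℝ, 0 ≤ C ∧ ∀ v : Fin N → E, ‖v i - v j‖ ^ 2 ≤ C * W.energy v := by
  obtain ⟨p⟩ := h
  induction p with
  | nil => exact ⟨0, le_rfl, fun v => by simp⟩
  | @cons i k j hik p ih =>
    obtain ⟨C, hC, h⟩ := ih
    have hpos := W.pos i k hik
    refine ⟨2 * (W.weight i k)⁻¹ + 2 * C, by positivity, fun v => ?_⟩
    have h1 : W.weight i k * ‖v i - v k‖ ^ 2 ≤ W.energy v := by
      refine le_trans ?_ (Finset.single_le_sum (f := fun i =>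
        ∑ j, W.weight i j * ‖v i - v j‖ ^ 2) (fun i _ => Finset.sum_nonneg fun j _ =>
          mul_nonneg (W.weight_nonneg i j) (by positivity)) (Finset.mem_univ i))
      exact Finset.single_le_sum (f := fun j => W.weight i j * ‖v i - v j‖ ^ 2) (fun j _ =>
        mul_nonneg (W.weight_nonneg i j) (by positivity)) (Finset.mem_univ k)
    have h2 : ‖v i - v k‖ ^ 2 ≤ (W.weight i k)⁻¹ * W.energy v := by
      rw [le_inv_mul_iff₀ hpos]; exact h1
    have h3 : ‖v i - v j‖ ≤ ‖v i - v k‖ + ‖v k - v j‖ := norm_sub_le_norm_sub_add_norm_sub _ _ _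
    have h4 := h v
    have h5 : ‖v i - v j‖ ^ 2 ≤ (‖v i - v k‖ + ‖v k - v j‖) ^ 2 := by gcongr
    nlinarith [sq_nonneg (‖v i - v k‖ - ‖v k - v j‖)]

/-- The Poincaré inequality of a connected graph. -/
theorem exists_sum_norm_sub_sq_le {E : Type*} [NormedAddCommGroup E] (hW : W.graph.Connected)
    (i₀ : Fin N) :
    ∃ C : ℝ, 0 < C ∧ ∀ v : Fin N → E, ∑ i, ‖v i - v i₀‖ ^ 2 ≤ C * W.energy v := by
  choose C hC h using fun i => W.exists_norm_sub_sq_le_of_reachable (E := E) (hW.preconnected i i₀)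
  refine ⟨∑ i, C i + 1, by have := Finset.sum_nonneg fun i (_ : i ∈ Finset.univ) => hC i; positivity,
    fun v => ?_⟩
  calc ∑ i, ‖v i - v i₀‖ ^ 2 ≤ ∑ i, C i * W.energy v := Finset.sum_le_sum fun i _ => h i v
    _ = (∑ i, C i) * W.energy v := by rw [Finset.sum_mul]
    _ ≤ _ := by nlinarith [W.energy_nonneg v]

theorem dotProduct_laplacian_mulVec (v : Fin N → ℝ) :
    v ⬝ᵥ (W.laplacian.mulVec v) = W.energy v / 2 := by
  rw [← W.sum_weight_inner_eq_energy]
  simp only [dotProduct, Matrix.mulVec]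
  refine Finset.sum_congr rfl fun i _ => ?_
  have h1 : ∀ j ∈ Finset.univ.erase i, W.laplacian i j * v j = -(W.weight i j * v j) := by
    intro j hj
    have : i ≠ j := (Finset.ne_of_mem_erase hj).symm
    simp [laplacian, this]
  rw [← Finset.add_sum_erase _ _ (Finset.mem_univ i), Finset.sum_congr rfl h1,
    ← Finset.add_sum_erase _ (fun j => W.weight i j * inner ℝ (v i) (v i - v j))
      (Finset.mem_univ i)]
  simp only [laplacian, Matrix.of_apply, if_true, sub_self, inner_zero_right, mul_zero, zero_add,
    Finset.sum_mul, ← Finset.sum_add_distrib, Finset.mul_sum]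
  refine Finset.sum_congr rfl fun j _ => ?_
  simp
  ring

/-- The energy of such an eigenvector is 2l‖v‖² ≤ 0, hence zero, and connectedness propagates
equality to all vertices. -/
theorem eq_of_mulVec_eq_smul (hW : W.graph.Connected) {v : Fin N → ℝ} {l : ℝ} (hl : l ≤ 0)
    (hv : W.laplacian.mulVec v = l • v) (i j : Fin N) : v i = v j := by
  have h1 := W.dotProduct_laplacian_mulVec v
  rw [hv, dotProduct_smul, smul_eq_mul] at h1
  have h2 : 0 ≤ v ⬝ᵥ v := Finset.sum_nonneg fun i _ => mul_self_nonneg _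
  have h3 : W.energy v ≤ 0 := by nlinarith
  obtain ⟨C, hC, h⟩ := W.exists_norm_sub_sq_le_of_reachable (E := ℝ) (hW.preconnected i j)
  have h4 : ‖v i - v j‖ ^ 2 ≤ 0 := (h v).trans (by nlinarith)
  have h5 : ‖v i - v j‖ = 0 := by
    have := sq_nonneg ‖v i - v j‖
    exact pow_eq_zero_iff two_ne_zero |>.1 (le_antisymm h4 this)
  exact sub_eq_zero.1 (norm_eq_zero.1 h5)

/-- Otherwise the two smallest eigenvalues are both nonpositive, so two orthonormal eigenvectors are
both constant, which is impossible. -/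
theorem lam2_pos (hN : 2 ≤ N) (hW : W.graph.Connected) : 0 < W.lam2 hN := by
  by_contra! hneg
  set hA := W.laplacian_isHermitian
  have hle : ascEig hA ⟨0, by omega⟩ ≤ ascEig hA ⟨1, by omega⟩ := ascEig_mono hA (by simp)
  have h0 : ascEig hA ⟨0, by omega⟩ ≤ 0 := hle.trans hneg
  have h1 : ascEig hA ⟨1, by omega⟩ ≤ 0 := hneg
  rw [ascEig_eq_eigenvalues] at h0 h1
  set a := (Fintype.equivOfCardEq (Fintype.card_fin (Fintype.card (Fin N))))
    (Fin.cast (Fintype.card_fin N).symm (⟨0, by omega⟩ : Fin N).rev) with ha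
  set b := (Fintype.equivOfCardEq (Fintype.card_fin (Fintype.card (Fin N))))
    (Fin.cast (Fintype.card_fin N).symm (⟨1, by omega⟩ : Fin N).rev) with hb
  have hne : a ≠ b := by
    intro hab
    rw [ha, hb, Equiv.apply_eq_iff_eq] at hab
    have := congrArg Fin.val hab
    simp at this
    omega
  have hconst : ∀ c, hA.eigenvalues c ≤ 0 → ∀ i,
      hA.eigenvectorBasis c i = hA.eigenvectorBasis c ⟨0, by omega⟩ := fun c hc i =>
    W.eq_of_mulVec_eq_smul hW hc (hA.mulVec_eigenvectorBasis c) i _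
  have horth := hA.eigenvectorBasis.orthonormal
  have hin : inner ℝ (hA.eigenvectorBasis a) (hA.eigenvectorBasis b) = 0 := horth.2 hne
  have hna : ‖hA.eigenvectorBasis a‖ ^ 2 = 1 := by rw [horth.1 a]; norm_num
  have hnb : ‖hA.eigenvectorBasis b‖ ^ 2 = 1 := by rw [horth.1 b]; norm_num
  rw [EuclideanSpace.norm_sq_eq] at hna hnb
  rw [PiLp.inner_apply] at hin
  simp only [hconst a h0, hconst b h1, Finset.sum_const, Finset.card_univ, Fintype.card_fin,
    nsmul_eq_mul, Real.norm_eq_abs, sq_abs] at hna hnb hin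
  simp at hin
  rcases hin with h | h | h
  · omega
  · rw [h] at hnb; simp at hnb
  · rw [h] at hna; simp at hna

theorem lamN_pos (hN : 2 ≤ N) (hW : W.graph.Connected) : 0 < W.lamN hN :=
  (W.lam2_pos hN hW).trans_le (ascEig_mono _ (by rw [Fin.le_def]; simp; omega))

/-- The Laplacian acting on stacked estimates. -/
def lap (W : CommGraph N) (d : Fin N → ℕ) : Stack d →L[ℝ] Stack d :=
  LinearMap.toContinuousLinearMap
    { toFun := fun v => WithLp.toLp 2 fun i => ∑ j, W.weight i j • (v i - v j)
      map_add' := fun v w => by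
        ext1 i
        simp only [PiLp.add_apply, ← Finset.sum_add_distrib, ← smul_add]
        refine Finset.sum_congr rfl fun j _ => ?_
        congr 1
        abel
      map_smul' := fun c v => by
        ext1 i
        simp only [PiLp.smul_apply, RingHom.id_apply, Finset.smul_sum, ← smul_sub]
        exact Finset.sum_congr rfl fun j _ => smul_comm _ _ _ }

theorem lap_apply (v : Stack d) (i : Fin N) :
    W.lap d v i = ∑ j, W.weight i j • (v i - v j) := rfl

theorem lap_const (z : Profile d) : W.lap d (WithLp.toLp 2 fun _ => z) = 0 := by
  ext1 i
  simp [lap_apply]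

theorem inner_lap (v : Stack d) : inner ℝ v (W.lap d v) = W.energy (fun i => v i) / 2 := by
  rw [← W.sum_weight_inner_eq_energy, PiLp.inner_apply]
  refine Finset.sum_congr rfl fun i _ => ?_
  rw [lap_apply, inner_sum]
  exact Finset.sum_congr rfl fun j _ => real_inner_smul_right _ _ _

end CommGraph

/-! ### Positive definite matrices -/

/-- The smallest eigenvalue of a positive definite matrix is positive. -/
theorem ascEig_pos {m : ℕ} {A : Matrix (Fin m) (Fin m) ℝ} (hA : A.PosDef) (k : Fin m) :
    0 < ascEig hA.isHermitian k := by
  rw [ascEig_eq_eigenvalues]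
  exact hA.eigenvalues_pos _

/-- Completing the square: a times the form is (a x₀ + b x₁)² + (ac - b²) x₁². -/
theorem posDef_of_det_pos {a b c : ℝ} (ha : 0 < a) (h : b ^ 2 < a * c) :
    (!![a, b; b, c] : Matrix (Fin 2) (Fin 2) ℝ).PosDef := by
  refine Matrix.PosDef.of_dotProduct_mulVec_pos ?_ fun x hx => ?_
  · ext i j
    fin_cases i <;> fin_cases j <;> simp
  · have h2 : star x ⬝ᵥ (!![a, b; b, c] : Matrix (Fin 2) (Fin 2) ℝ).mulVec x =
        a * x 0 ^ 2 + 2 * b * x 0 * x 1 + c * x 1 ^ 2 := by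
      simp [dotProduct, Matrix.mulVec, Fin.sum_univ_two]
      ring
    rw [h2]
    have h3 : 0 < a * (a * x 0 ^ 2 + 2 * b * x 0 * x 1 + c * x 1 ^ 2) := by
      have h4 : a * (a * x 0 ^ 2 + 2 * b * x 0 * x 1 + c * x 1 ^ 2) =
        (a * x 0 + b * x 1) ^ 2 + (a * c - b ^ 2) * x 1 ^ 2 := by ring
      rw [h4]
      by_cases h1 : x 1 = 0
      · have h0 : x 0 ≠ 0 := by
          intro h0
          apply hx
          ext i
          fin_cases i <;> simp [h0, h1]
        rw [h1]
        simp
        positivity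
      · have : 0 < a * c - b ^ 2 := by linarith
        positivity
    exact (mul_pos_iff_of_pos_left ha).1 h3

/-! ### The game -/

theorem replaceAction_self (x : Profile d) (i : Fin N) : replaceAction x i (x i) = x := by
  ext1 j
  simp [replaceAction]

theorem replaceAction_apply_same (x : Profile d) (i : Fin N) (z : EuclideanSpace ℝ (Fin (d i))) :
    replaceAction x i z i = z := by
  simp [replaceAction]

theorem replaceAction_apply_of_ne (x : Profile d) {i j : Fin N} (h : j ≠ i)
    (z : EuclideanSpace ℝ (Fin (d i))) : replaceAction x i z j = x j := by
  simp [replaceAction, h]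

/-- On the line from x to z the function is convex with zero derivative at 0, so its slope between 0
and 1 is nonnegative. -/
theorem le_of_convexOn_of_gradient_eq_zero {E : Type*} [NormedAddCommGroup E]
    [InnerProductSpace ℝ E] [CompleteSpace E] {f : E → ℝ} (hf : ConvexOn ℝ Set.univ f) {x : E}
    (hd : DifferentiableAt ℝ f x) (h0 : gradient f x = 0) (z : E) : f x ≤ f z := by
  have hg : HasFDerivAt f (0 : E →L[ℝ] ℝ) x := by
    have := hd.hasGradientAt.hasFDerivAt
    rwa [h0, map_zero] at this
  have hc : ConvexOn ℝ Set.univ (f ∘ AffineMap.lineMap (k := ℝ) x z) := by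
    simpa using hf.comp_affineMap (AffineMap.lineMap (k := ℝ) x z)
  have h1 : HasDerivAt (f ∘ AffineMap.lineMap (k := ℝ) x z) 0 0 := by
    have hg' : HasFDerivAt f (0 : E →L[ℝ] ℝ) (AffineMap.lineMap (k := ℝ) x z 0) := by simpa using hg
    simpa using hg'.comp_hasDerivAt (0 : ℝ) AffineMap.hasDerivAt_lineMap
  have := hc.le_slope_of_hasDerivAt (Set.mem_univ 0) (Set.mem_univ 1) one_pos h1
  simpa [slope_def_field] using this

theorem isNash_of_gameMap_eq_zero {J : Fin N → Profile d → ℝ} (hJ : RegularCosts J) {x : Profile d}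
    (hx : gameMap J x = 0) : IsNash J x := by
  intro i z
  have h0 : ownGrad J i x = 0 := congrArg (fun w : Profile d => w i) hx
  have := le_of_convexOn_of_gradient_eq_zero (hJ.strictConvex i x).convexOn
    ((hJ.contDiff i x).differentiable one_ne_zero (x i)) h0 z
  rwa [replaceAction_self] at this

namespace MonotoneLipschitz

variable {J : Fin N → Profile d → ℝ} {μ : ℝ} {θown θother : Fin N → ℝ}

/-- Pass through the profile in which only player i has moved to its new action, using one Lipschitz
condition on each leg. Summing over all players gives one constant for every i. -/
theorem norm_ownGrad_sub_le (hF : MonotoneLipschitz J μ θown θother) (i : Fin N)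
    (x y : Profile d) :
    ‖ownGrad J i x - ownGrad J i y‖ ≤ (∑ j, (θown j + θother j)) * ‖x - y‖ := by
  set m := replaceAction x i (y i) with hm
  have h1 := hF.lip_own i x m fun j hj => (replaceAction_apply_of_ne x hj _).symm
  have h2 := hF.lip_other i m y (replaceAction_apply_same x i _)
  rw [hm, replaceAction_apply_same, ← hm] at h1
  have h3 : ‖x i - y i‖ ≤ ‖x - y‖ := PiLp.norm_apply_le (x - y) i
  have h4 : ‖m - y‖ ≤ ‖x - y‖ := by
    refine le_of_sq_le_sq ?_ (norm_nonneg _)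
    rw [PiLp.norm_sq_eq_of_L2, PiLp.norm_sq_eq_of_L2]
    refine Finset.sum_le_sum fun j _ => ?_
    by_cases hj : j = i
    · subst hj
      simp only [PiLp.sub_apply, hm, replaceAction_apply_same, sub_self, norm_zero]
      simp
    · simp only [PiLp.sub_apply, hm, replaceAction_apply_of_ne x hj]
      exact le_rfl
  have h5 : θown i + θother i ≤ ∑ j, (θown j + θother j) :=
    Finset.single_le_sum (f := fun j => θown j + θother j)
      (fun j _ => add_nonneg (hF.own_nonneg j) (hF.other_nonneg j)) (Finset.mem_univ i)
  calc ‖ownGrad J i x - ownGrad J i y‖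
      ≤ ‖ownGrad J i x - ownGrad J i m‖ + ‖ownGrad J i m - ownGrad J i y‖ :=
        norm_sub_le_norm_sub_add_norm_sub _ _ _
    _ ≤ θown i * ‖x - y‖ + θother i * ‖x - y‖ := by
      refine add_le_add (h1.trans ?_) (h2.trans ?_)
      · exact mul_le_mul_of_nonneg_left h3 (hF.own_nonneg i)
      · exact mul_le_mul_of_nonneg_left h4 (hF.other_nonneg i)
    _ = (θown i + θother i) * ‖x - y‖ := by ring
    _ ≤ _ := by gcongr

end MonotoneLipschitz

/-- A strongly monotone Lipschitz map of a Hilbert space has a zero. -/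
theorem exists_eq_zero_of_strongly_monotone {H : Type*} [NormedAddCommGroup H]
    [InnerProductSpace ℝ H] [CompleteSpace H] {F : H → H} {μ K : ℝ} (hμ : 0 < μ)
    (hmono : ∀ x y, μ * ‖x - y‖ ^ 2 ≤ inner ℝ (F x - F y) (x - y))
    (hlip : ∀ x y, ‖F x - F y‖ ≤ K * ‖x - y‖) : ∃ x, F x = 0 := by
  -- Step length making x ↦ x - τF(x) a contraction: 1 - 2τμ + τ²K² ≤ 1 - τμ. The term μ² keeps τ
  -- meaningful for K = 0 and ensures τμ ≤ 1.
  set τ := μ / (K ^ 2 + μ ^ 2) with hτ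
  have hden : 0 < K ^ 2 + μ ^ 2 := by positivity
  have hτpos : 0 < τ := by positivity
  have hcon : ∀ x y, ‖(x - τ • F x) - (y - τ • F y)‖ ^ 2 ≤
      (1 - τ * μ) * ‖x - y‖ ^ 2 := by
    intro x y
    have h1 : (x - τ • F x) - (y - τ • F y) = (x - y) - τ • (F x - F y) := by
      rw [smul_sub]; abel
    rw [h1, norm_sub_sq_real, real_inner_smul_right, norm_smul, real_inner_comm, mul_pow,
      Real.norm_eq_abs, sq_abs]
    have h2 : ‖F x - F y‖ ^ 2 ≤ K ^ 2 * ‖x - y‖ ^ 2 := by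
      rw [← mul_pow]; exact pow_le_pow_left₀ (norm_nonneg _) (hlip x y) 2
    have h3 := mul_le_mul_of_nonneg_left (hmono x y) hτpos.le
    have h4 := mul_le_mul_of_nonneg_left h2 (sq_nonneg τ)
    have h5 : τ * (K ^ 2 + μ ^ 2) = μ := by rw [hτ]; field_simp
    have h6 : τ ^ 2 * K ^ 2 ≤ τ * μ := by nlinarith [sq_nonneg (τ * μ)]
    have h7 := mul_le_mul_of_nonneg_right h6 (sq_nonneg ‖x - y‖)
    nlinarith
  have hlt : 1 - τ * μ < 1 := by nlinarith
  have hnn : 0 ≤ 1 - τ * μ := by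
    have h5 : τ * (K ^ 2 + μ ^ 2) = μ := by rw [hτ]; field_simp
    have : τ * μ ≤ 1 := by
      rw [hτ, div_mul_eq_mul_div, div_le_one hden]; nlinarith [sq_nonneg K]
    linarith
  have hC : ContractingWith (Real.toNNReal (Real.sqrt (1 - τ * μ))) fun x => x - τ • F x := by
    refine ⟨?_, LipschitzWith.of_dist_le_mul fun x y => ?_⟩
    · rw [← NNReal.coe_lt_coe, Real.coe_toNNReal _ (Real.sqrt_nonneg _), NNReal.coe_one]
      exact (Real.sqrt_lt' one_pos).2 (by simpa using hlt)
    · rw [Real.coe_toNNReal _ (Real.sqrt_nonneg _), dist_eq_norm, dist_eq_norm]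
      refine le_of_sq_le_sq ?_ (by positivity)
      rw [mul_pow, Real.sq_sqrt hnn]
      exact hcon x y
  obtain ⟨p, hp⟩ : ∃ p, p - τ • F p = p := ⟨_, hC.fixedPoint_isFixedPt⟩
  refine ⟨p, ?_⟩
  have h2 : τ • F p = 0 := sub_eq_self.1 hp
  exact (smul_eq_zero.1 h2).resolve_left hτpos.ne'

theorem MonotoneLipschitz.exists_gameMap_eq_zero {J : Fin N → Profile d → ℝ} {μ : ℝ}
    {θown θother : Fin N → ℝ} (hF : MonotoneLipschitz J μ θown θother) :
    ∃ x, gameMap J x = 0 := by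
  set Θ := ∑ j, (θown j + θother j)
  have hΘ : 0 ≤ Θ := Finset.sum_nonneg fun j _ => add_nonneg (hF.own_nonneg j) (hF.other_nonneg j)
  refine exists_eq_zero_of_strongly_monotone hF.mu_pos hF.strongMono (K := Real.sqrt N * Θ)
    fun x y => le_of_sq_le_sq ?_ (by positivity)
  rw [PiLp.norm_sq_eq_of_L2, mul_pow, mul_pow, Real.sq_sqrt (by positivity)]
  have : ∀ i ∈ Finset.univ, ‖(gameMap J x - gameMap J y) i‖ ^ 2 ≤ (Θ * ‖x - y‖) ^ 2 := fun i _ =>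
    pow_le_pow_left₀ (norm_nonneg _) (hF.norm_ownGrad_sub_le i x y) 2
  refine (Finset.sum_le_sum this).trans (le_of_eq ?_)
  simp
  ring

/-! ### The consensus-augmented game map -/

/-- The stacked gradients `R_i ∇_i J_i(𝒙^i)`, without the factor `ε`. -/
def gradStack (J : Fin N → Profile d → ℝ) (v : Stack d) : Stack d :=
  WithLp.toLp 2 fun i => WithLp.toLp 2 (Pi.single i (ownGrad J i (v i)))

theorem gradStack_apply_same (J : Fin N → Profile d → ℝ) (v : Stack d) (i : Fin N) :
    gradStack J v i i = ownGrad J i (v i) := by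
  simp [gradStack]

theorem gradStack_apply_of_ne (J : Fin N → Profile d → ℝ) (v : Stack d) {i j : Fin N}
    (h : j ≠ i) : gradStack J v i j = 0 := by
  simp [gradStack, h]

theorem inner_gradStack (J : Fin N → Profile d → ℝ) (y v : Stack d) :
    inner ℝ y (gradStack J v) = ∑ i, inner ℝ (y i i) (ownGrad J i (v i)) := by
  rw [PiLp.inner_apply]
  refine Finset.sum_congr rfl fun i _ => ?_
  rw [PiLp.inner_apply, Finset.sum_eq_single i, gradStack_apply_same]
  · intro j _ hj
    rw [gradStack_apply_of_ne J v hj, inner_zero_right]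
  · simp

theorem MonotoneLipschitz.norm_gradStack_sub_le {J : Fin N → Profile d → ℝ} {μ : ℝ}
    {θown θother : Fin N → ℝ} (hF : MonotoneLipschitz J μ θown θother) (v w : Stack d) :
    ‖gradStack J v - gradStack J w‖ ≤ (∑ j, (θown j + θother j)) * ‖v - w‖ := by
  have hΘ : 0 ≤ ∑ j, (θown j + θother j) :=
    Finset.sum_nonneg fun j _ => add_nonneg (hF.own_nonneg j) (hF.other_nonneg j)
  refine le_of_sq_le_sq ?_ (by positivity)
  rw [mul_pow, PiLp.norm_sq_eq_of_L2, PiLp.norm_sq_eq_of_L2 _ (v - w), Finset.mul_sum]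
  refine Finset.sum_le_sum fun i _ => ?_
  rw [PiLp.norm_sq_eq_of_L2, Finset.sum_eq_single i]
  · rw [PiLp.sub_apply, PiLp.sub_apply, gradStack_apply_same, gradStack_apply_same, ← mul_pow]
    exact pow_le_pow_left₀ (norm_nonneg _) (hF.norm_ownGrad_sub_le i _ _) 2
  · intro j _ hj
    simp [gradStack_apply_of_ne J _ hj]
  · simp

theorem gradStack_const_eq_zero {J : Fin N → Profile d → ℝ} {x : Profile d}
    (hx : gameMap J x = 0) : gradStack J (WithLp.toLp 2 fun _ => x) = 0 := by
  have h0 : ∀ i, ownGrad J i x = 0 := fun i => congrArg (fun w : Profile d => w i) hx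
  ext1 i
  ext1 j
  by_cases h : j = i
  · subst h
    rw [gradStack_apply_same, h0]; rfl
  · rw [gradStack_apply_of_ne J _ h]; rfl

/-- Strong monotonicity of the consensus-augmented game mapping at an equilibrium, for a large
coupling gain. -/
theorem MonotoneLipschitz.exists_augmented_coercive {J : Fin N → Profile d → ℝ} {μ : ℝ}
    {θown θother : Fin N → ℝ} (hF : MonotoneLipschitz J μ θown θother) (W : CommGraph N)
    (hW : W.graph.Connected) (hN : 0 < N) :
    ∃ κ₀ : ℝ, 0 < κ₀ ∧ ∀ κ, κ₀ ≤ κ → ∀ x, gameMap J x = 0 → ∀ v : Stack d,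
      μ / (4 * N) * ‖v - WithLp.toLp 2 fun _ => x‖ ^ 2 ≤
        κ * inner ℝ (v - WithLp.toLp 2 fun _ => x) (W.lap d (v - WithLp.toLp 2 fun _ => x)) +
          inner ℝ (v - WithLp.toLp 2 fun _ => x) (gradStack J v) := by
  obtain ⟨C, hC, hP⟩ := W.exists_sum_norm_sub_sq_le (E := Profile d) hW ⟨0, hN⟩
  set Θ := ∑ j, (θown j + θother j) with hΘdef
  have hΘ : 0 ≤ Θ := Finset.sum_nonneg fun j _ => add_nonneg (hF.own_nonneg j) (hF.other_nonneg j)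
  have hμ := hF.mu_pos
  have hNR : (0 : ℝ) < N := by exact_mod_cast hN
  -- The first two summands cancel the loss in `hgrad`, the third remains to control the
  -- disagreement. The factor 2C comes from the Poincaré constant and from the form being half the
  -- energy.
  refine ⟨2 * C * (2 * N * Θ ^ 2 / μ + Θ + μ / (2 * N)), by positivity,
    fun κ hκ x hx v => ?_⟩
  have hκ0 : 0 ≤ κ := le_trans (by positivity) hκ
  set y : Stack d := v - WithLp.toLp 2 fun _ => x with hy
  -- The error of one fixed player serves as the common part, in place of the average; S measures
  -- the disagreement with it.
  set z : Profile d := y ⟨0, hN⟩ with hz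
  have hvi : ∀ i, v i = x + y i := fun i => by simp [hy]
  have h0 : ∀ i, ownGrad J i x = 0 := fun i => congrArg (fun w : Profile d => w i) hx
  set S := ∑ i, ‖y i - z‖ ^ 2 with hS
  have hS0 : 0 ≤ S := Finset.sum_nonneg fun i _ => by positivity
  have hlap : (2 * N * Θ ^ 2 / μ + Θ + μ / (2 * N)) * S ≤ κ * inner ℝ y (W.lap d y) := by
    rw [W.inner_lap]
    have h1 : S ≤ C * W.energy fun i => y i := hP _
    have h2 := W.energy_nonneg fun i => y i
    have h3 : 0 ≤ 2 * N * Θ ^ 2 / μ + Θ + μ / (2 * N) := by positivity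
    have h4 := mul_le_mul_of_nonneg_left h1 h3
    have h5 := mul_le_mul_of_nonneg_right hκ h2
    nlinarith
  have hnorm : ‖y‖ ^ 2 ≤ 2 * N * ‖z‖ ^ 2 + 2 * S := by
    rw [PiLp.norm_sq_eq_of_L2]
    have h1 : ∀ i ∈ Finset.univ, ‖y i‖ ^ 2 ≤ 2 * ‖z‖ ^ 2 + 2 * ‖y i - z‖ ^ 2 := by
      intro i _
      have h2 : ‖y i‖ ≤ ‖y i - z‖ + ‖z‖ := norm_le_norm_sub_add _ _
      have h3 : ‖y i‖ ^ 2 ≤ (‖y i - z‖ + ‖z‖) ^ 2 := by gcongr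
      nlinarith [sq_nonneg (‖y i - z‖ - ‖z‖)]
    refine (Finset.sum_le_sum h1).trans (le_of_eq ?_)
    rw [Finset.sum_add_distrib, ← Finset.mul_sum _ (fun i => ‖y i - z‖ ^ 2), ← hS]
    simp
    ring
  have hgrad : μ / 2 * ‖z‖ ^ 2 - (2 * N * Θ ^ 2 / μ + Θ) * S ≤ inner ℝ y (gradStack J v) := by
    rw [inner_gradStack]
    have hmono : μ * ‖z‖ ^ 2 ≤ ∑ i, inner ℝ (z i) (ownGrad J i (x + z)) := by
      have h1 := hF.strongMono (x + z) x
      rw [hx, sub_zero, add_sub_cancel_left, PiLp.inner_apply] at h1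
      refine h1.trans (le_of_eq (Finset.sum_congr rfl fun i _ => ?_))
      rw [real_inner_comm]
      rfl
    have hterm : ∀ i ∈ Finset.univ, inner ℝ (z i) (ownGrad J i (x + z)) - μ / (2 * N) * ‖z‖ ^ 2 -
        (2 * N * Θ ^ 2 / μ + Θ) * ‖y i - z‖ ^ 2 ≤ inner ℝ (y i i) (ownGrad J i (v i)) := by
      intro i _
      have e1 : inner ℝ (y i i) (ownGrad J i (v i)) = inner ℝ (z i) (ownGrad J i (x + z)) +
          inner ℝ (z i) (ownGrad J i (v i) - ownGrad J i (x + z)) +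
          inner ℝ ((y i - z) i) (ownGrad J i (v i)) := by
        rw [show (y i - z) i = y i i - z i from rfl, inner_sub_right, inner_sub_left]; ring
      have l1 : ‖ownGrad J i (v i) - ownGrad J i (x + z)‖ ≤ Θ * ‖y i - z‖ := by
        have := hF.norm_ownGrad_sub_le i (v i) (x + z)
        rwa [hvi, add_sub_add_left_eq_sub, ← hvi] at this
      have l2 : ‖ownGrad J i (v i)‖ ≤ Θ * ‖y i‖ := by
        have := hF.norm_ownGrad_sub_le i (v i) x
        rw [h0, sub_zero] at this
        rwa [hvi, add_sub_cancel_left, ← hvi] at this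
      have l3 : ‖y i‖ ≤ ‖y i - z‖ + ‖z‖ := norm_le_norm_sub_add _ _
      have b1 := (abs_le.1 (abs_real_inner_le_norm (z i)
        (ownGrad J i (v i) - ownGrad J i (x + z)))).1
      have b2 := (abs_le.1 (abs_real_inner_le_norm ((y i - z) i) (ownGrad J i (v i)))).1
      have b3 : ‖z i‖ * ‖ownGrad J i (v i) - ownGrad J i (x + z)‖ ≤ ‖z‖ * (Θ * ‖y i - z‖) := by
        gcongr
        exact PiLp.norm_apply_le z i
      have b4 : ‖(y i - z) i‖ * ‖ownGrad J i (v i)‖ ≤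
          ‖y i - z‖ * (Θ * (‖y i - z‖ + ‖z‖)) := by
        gcongr
        · exact PiLp.norm_apply_le (y i - z) i
        · exact l2.trans (by gcongr)
      -- Young's inequality, weighted so that the N terms in ‖z‖² use exactly half of the strong
      -- monotonicity.
      have b5 : 2 * Θ * ‖z‖ * ‖y i - z‖ ≤
          μ / (2 * N) * ‖z‖ ^ 2 + 2 * N * Θ ^ 2 / μ * ‖y i - z‖ ^ 2 := by
        have h6 : μ / (2 * N) * ‖z‖ ^ 2 + 2 * N * Θ ^ 2 / μ * ‖y i - z‖ ^ 2 -
            2 * Θ * ‖z‖ * ‖y i - z‖ =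
            μ / (2 * N) * (‖z‖ - 2 * N * Θ / μ * ‖y i - z‖) ^ 2 := by
          field_simp
          ring
        have h7 : 0 ≤ μ / (2 * N) * (‖z‖ - 2 * N * Θ / μ * ‖y i - z‖) ^ 2 := by positivity
        linarith
      rw [e1]
      nlinarith
    refine le_trans ?_ (Finset.sum_le_sum hterm)
    rw [Finset.sum_sub_distrib, Finset.sum_sub_distrib, ← Finset.mul_sum _ _ (2 * N * Θ ^ 2 / μ + Θ),
      ← hS]
    simp only [Finset.sum_const, Finset.card_univ, Fintype.card_fin, nsmul_eq_mul]
    have : (N : ℝ) * (μ / (2 * N) * ‖z‖ ^ 2) = μ / 2 * ‖z‖ ^ 2 := by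
      field_simp
    linarith
  have hfin : μ / (4 * N) * ‖y‖ ^ 2 ≤ μ / 2 * ‖z‖ ^ 2 + μ / (2 * N) * S := by
    calc μ / (4 * N) * ‖y‖ ^ 2 ≤ μ / (4 * N) * (2 * N * ‖z‖ ^ 2 + 2 * S) := by gcongr
      _ = _ := by field_simp; ring
  nlinarith

/-! ### The closed loop -/

/-- The stacked decoded values after `k` steps. -/
def decodedStack (c : Consts) (p : Design) (x : ℝ → Stack d) (k : ℕ) : Stack d :=
  WithLp.toLp 2 fun i => decode p.L (scaling c p) (fun m => x (m * p.T) i) k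

theorem velocity_eq (W : CommGraph N) (J : Fin N → Profile d → ℝ) (c : Consts) (p : Design)
    (x : ℝ → Stack d) (t : ℝ) :
    velocity W J c p x t =
      -((p.α • W.lap d) (decodedStack c p x ⌊t / p.T⌋₊)) - p.ε • gradStack J (x t) := by
  ext1 i
  have h1 : p.α • ∑ j, W.weight i j • (estimate c p x j t - estimate c p x i t) =
      -((p.α • W.lap d) (decodedStack c p x ⌊t / p.T⌋₊)) i := by
    rw [smul_apply, PiLp.smul_apply, W.lap_apply, ← smul_neg,
      ← Finset.sum_neg_distrib]
    congr 1
    refine Finset.sum_congr rfl fun j _ => ?_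
    rw [← smul_neg, neg_sub]
    rfl
  have h2 : (WithLp.toLp 2 (Pi.single i (p.ε • ownGrad J i (x t i))) : Profile d) =
      (p.ε • gradStack J (x t)) i := by
    rw [PiLp.smul_apply, gradStack, Pi.single_smul, WithLp.toLp_smul]
  simp only [velocity]
  rw [h1, h2]
  rfl

theorem floor_div_eq {T t : ℝ} (hT : 0 < T) {k : ℕ} (h1 : k * T ≤ t) (h2 : t < (k + 1) * T) :
    ⌊t / T⌋₊ = k := by
  have h0 : 0 ≤ t := le_trans (by positivity) h1
  rw [Nat.floor_eq_iff (by positivity)]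
  exact ⟨(le_div_iff₀ hT).2 h1, (div_lt_iff₀ hT).2 h2⟩

theorem exists_mem_sampling_interval {T t : ℝ} (hT : 0 < T) (ht : 0 ≤ t) :
    (⌊t / T⌋₊ : ℝ) * T ≤ t ∧ t < (⌊t / T⌋₊ + 1) * T :=
  ⟨(le_div_iff₀ hT).1 (Nat.floor_le (by positivity)),
    (div_lt_iff₀ hT).1 (Nat.lt_floor_add_one _)⟩

theorem norm_le_of_quantization_error {L : ℕ} {s : ℝ} (hs : 0 < s) {v w : Stack d}
    (hv : ∀ i, SupBound (v i) (s * (L + 1 / 2)))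
    (hw : ∀ i, w i = v i - s • quantizeVec L (s⁻¹ • v i)) :
    ‖w‖ ≤ Real.sqrt (N * (∑ i, d i : ℕ)) * s / 2 := by
  refine le_of_sq_le_sq ?_ (by positivity)
  rw [PiLp.norm_sq_eq_of_L2, mul_div_assoc, mul_pow, Real.sq_sqrt (by positivity)]
  have : ∀ i ∈ Finset.univ, ‖w i‖ ^ 2 ≤ (∑ i, d i : ℕ) * (s / 2) ^ 2 := fun i _ => by
    rw [hw]; exact norm_sub_smul_quantizeVec_le hs (hv i)
  refine (Finset.sum_le_sum this).trans (le_of_eq ?_)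
  simp
  ring

theorem scaling_eq (c : Consts) (p : Design) (k : ℕ) :
    scaling c p k = s0 c p * Real.exp (-rate c p * (k * p.T)) := by
  rw [scaling, mul_assoc]

/-- Exponential convergence of the closed loop as long as the quantizer range covers the bound `E`
on the prediction error. -/
theorem norm_sub_le_of_isSolution {W : CommGraph N} {J : Fin N → Profile d → ℝ} {c : Consts}
    {p : Design} {x : ℝ → Stack d} {xs : Stack d} {γ K Γ Y q E : ℝ} (hx : IsSolution W J c p x)
    (hγp : rate c p = γ) (hγ : 0 < γ) (hT : 0 < p.T) (hs : 0 < s0 c p)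
    (hlapxs : W.lap d xs = 0)
    (hcoer : ∀ v : Stack d, 2 * γ * ‖v - xs‖ ^ 2 ≤
      inner ℝ (v - xs) ((p.α • W.lap d) (v - xs)) + inner ℝ (v - xs) (p.ε • gradStack J v))
    (hgrad : ∀ v : Stack d, ‖p.ε • gradStack J v‖ ≤ K * ‖v - xs‖)
    (hlap : ∀ v, ‖(p.α • W.lap d) v‖ ≤ Γ * ‖v‖)
    (hK0 : 0 ≤ K) (hΓ : 0 < Γ) (hY : 0 < Y) (hq0 : 0 ≤ q) (hK : K * p.T ≤ 1 / 4)
    (hE : (q + 2 * (Γ * (Y + q) + K * Y) * p.T) * Real.exp (γ * p.T) ≤ E)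
    (hEY : Γ * E < γ * Y) (hq : Real.sqrt (N * (∑ i, d i : ℕ)) * s0 c p / 2 ≤ q)
    (hL : E ≤ s0 c p * (p.L + 1 / 2)) (hY0 : ‖x 0 - xs‖ ≤ Y)
    (hsup : ∀ i, SupBound (x 0 i) (s0 c p * (p.L + 1 / 2))) :
    ∀ t, 0 ≤ t → ‖x t - xs‖ ≤ Y * Real.exp (-γ * t) := by
  set a : ℕ → ℝ := fun k => k * p.T with ha
  have hstep : ∀ k : ℕ, ‖x (a k) - xs‖ ≤ Y * Real.exp (-γ * a k) →
      ‖decodedStack c p x k - x (a k)‖ ≤ q * Real.exp (-γ * a k) →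
      ∀ t ∈ Set.Icc (a k) (a (k + 1)), ‖x t - xs‖ ≤ Y * Real.exp (-γ * t) ∧
        ‖decodedStack c p x k - x t‖ ≤ E * Real.exp (-γ * t) := by
    intro k h1 h2 t ht
    have hba : a (k + 1) - a k = p.T := by simp only [ha]; push_cast; ring
    have hak : 0 ≤ a k := by positivity
    have := norm_le_of_held_feedback (A := p.α • W.lap d) (y := fun t => x t - xs)
      (r := fun t => p.ε • gradStack J (x t)) (h := decodedStack c p x k - xs)
      (a := a k) (b := a (k + 1)) (γ := γ) (K := K) (Γ := Γ) (Y := Y) (q := q) (E := E)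
      ((hx.1.mono fun t ht => hak.trans ht.1).sub continuousOn_const) ?_ (fun t => hgrad _) hlap
      (fun t => hcoer _) (by linarith) hγ hK0 hΓ hY hq0 (by rwa [hba]) (by rwa [hba]) hEY h1
      (by simpa using h2) t ht
    · simpa using this
    · intro t ht
      have hder := hx.2 t (hak.trans ht.1)
      rw [velocity_eq, floor_div_eq hT (k := k) ht.1 (by simpa [ha] using ht.2)] at hder
      have h3 : (p.α • W.lap d) (decodedStack c p x k - xs) =
          (p.α • W.lap d) (decodedStack c p x k) := by
        rw [map_sub, smul_apply _ _ xs, hlapxs, smul_zero, sub_zero]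
      rw [h3]
      exact hder.sub_const _
  -- The invariant holds just after each message. Before message k + 1 the prediction error is at
  -- most E e^{-γt}, within the unsaturated range by `hL`; quantization then reduces it to q
  -- e^{-γt}. The first message has no prediction and relies on `hsup`.
  have hind : ∀ k : ℕ, ‖x (a k) - xs‖ ≤ Y * Real.exp (-γ * a k) ∧
      ‖decodedStack c p x k - x (a k)‖ ≤ q * Real.exp (-γ * a k) := by
    intro k
    induction k with
    | zero =>
      refine ⟨by simpa [ha] using hY0, ?_⟩
      rw [norm_sub_rev]
      have h0 : scaling c p 0 = s0 c p := by simp [scaling]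
      have := norm_le_of_quantization_error (L := p.L) hs (v := x 0)
        (w := x 0 - decodedStack c p x 0) hsup fun i => by simp [decodedStack, decode, h0]
      simpa [ha] using this.trans hq
    | succ k ih =>
      have h := hstep k ih.1 ih.2 (a (k + 1)) ⟨by simp only [ha]; push_cast; nlinarith, le_rfl⟩
      refine ⟨h.1, ?_⟩
      rw [norm_sub_rev]
      have hsc : scaling c p (k + 1) = s0 c p * Real.exp (-γ * a (k + 1)) := by
        rw [scaling_eq, hγp]
      have hspos : 0 < scaling c p (k + 1) := by rw [hsc]; positivity
      have := norm_le_of_quantization_error (L := p.L) hspos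
        (v := x (a (k + 1)) - decodedStack c p x k)
        (w := x (a (k + 1)) - decodedStack c p x (k + 1)) (fun i => supBound_of_norm_le ?_)
        fun i => by
          simp only [decodedStack, decode, PiLp.sub_apply, ha]
          abel
      · refine this.trans ?_
        rw [hsc]
        calc Real.sqrt (N * (∑ i, d i : ℕ)) * (s0 c p * Real.exp (-γ * a (k + 1))) / 2
            = Real.sqrt (N * (∑ i, d i : ℕ)) * s0 c p / 2 * Real.exp (-γ * a (k + 1)) := by ring
          _ ≤ _ := by gcongr
      · refine (PiLp.norm_apply_le (x (a (k + 1)) - decodedStack c p x k) i).trans ?_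
        rw [norm_sub_rev, hsc]
        refine h.2.trans ?_
        calc E * Real.exp (-γ * a (k + 1))
            ≤ (s0 c p * (p.L + 1 / 2)) * Real.exp (-γ * a (k + 1)) := by gcongr
          _ = _ := by ring
  intro t ht
  obtain ⟨h1, h2⟩ := exists_mem_sampling_interval hT ht
  exact (hstep _ (hind _).1 (hind _).2 t ⟨h1, by simpa [ha] using h2.le⟩).1

/-! ### Existence of solutions -/

/-- Gluing curves defined on consecutive intervals of length `T`. -/
theorem continuousOn_Ici_of_continuousOn_Icc {X : Type*} [TopologicalSpace X] {x : ℝ → X} {T : ℝ}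
    (hT : 0 < T) (h : ∀ k : ℕ, ContinuousOn x (Set.Icc (k * T) ((k + 1) * T))) :
    ContinuousOn x (Set.Ici 0) := by
  have hall : ∀ k : ℕ, ContinuousOn x (Set.Icc 0 (k * T)) := by
    intro k
    induction k with
    | zero => simp
    | succ k ih =>
      have := ih.union_of_isClosed (h k) isClosed_Icc isClosed_Icc
      rw [Set.Icc_union_Icc_eq_Icc (by positivity) (by nlinarith)] at this
      push_cast
      exact this
  intro t ht
  obtain ⟨k, hk⟩ := exists_nat_gt (t / T)
  have htk : t < k * T := (div_lt_iff₀ hT).1 hk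
  refine (hall k t ⟨ht, htk.le⟩).mono_of_mem_nhdsWithin ?_
  filter_upwards [self_mem_nhdsWithin, mem_nhdsWithin_of_mem_nhds (Iio_mem_nhds htk)] with s h1 h2
  exact ⟨h1, le_of_lt h2⟩

/-- Within a period the decoded value is frozen, so the equation is autonomous and Lipschitz and is
solvable over the whole period. The period does not depend on the state, so restarting at each
sampling instant reaches all times. -/
theorem exists_isSolution {W : CommGraph N} {J : Fin N → Profile d → ℝ} {c : Consts} {p : Design}
    {K : ℝ≥0} (hlip : LipschitzWith K fun v : Stack d => p.ε • gradStack J v) (hT : 0 < p.T)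
    (hK : K * p.T ≤ 1 / 2) (z : Stack d) : ∃ x, IsSolution W J c p x ∧ x 0 = z := by
  have hflow : ∀ w x₀ : Stack d, ∃ X : ℝ → Stack d, X 0 = x₀ ∧ ∀ t ∈ Set.Icc 0 p.T,
      HasDerivWithinAt X (-((p.α • W.lap d) w) - p.ε • gradStack J (X t)) (Set.Icc 0 p.T) t := by
    intro w x₀
    refine exists_solution_of_lipschitz
      (f := fun v => -((p.α • W.lap d) w) - p.ε • gradStack J v) (K := K) ?_ hT.le hK x₀
    refine LipschitzWith.of_dist_le_mul fun u v => ?_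
    rw [dist_sub_left]
    exact hlip.dist_le_mul u v
  choose Φ hΦ0 hΦ using hflow
  let quant : ℝ → Stack d → Stack d := fun s v =>
    WithLp.toLp 2 fun i => s • quantizeVec p.L (s⁻¹ • v i)
  -- The recursion carries the state at time kT together with the decoded value, updated from the
  -- end of the previous flow.
  let st : ℕ → Stack d × Stack d := fun k => Nat.rec (z, quant (scaling c p 0) z)
    (fun k u => (Φ u.2 u.1 p.T, u.2 + quant (scaling c p (k + 1)) (Φ u.2 u.1 p.T - u.2))) k
  have hst1 : ∀ k, (st (k + 1)).1 = Φ (st k).2 (st k).1 p.T := fun k => rfl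
  have hst2 : ∀ k, (st (k + 1)).2 =
      (st k).2 + quant (scaling c p (k + 1)) ((st (k + 1)).1 - (st k).2) := fun k => rfl
  let x : ℝ → Stack d := fun t => Φ (st ⌊t / p.T⌋₊).2 (st ⌊t / p.T⌋₊).1 (t - ⌊t / p.T⌋₊ * p.T)
  have hxk : ∀ k : ℕ, ∀ t, k * p.T ≤ t → t < (k + 1) * p.T →
      x t = Φ (st k).2 (st k).1 (t - k * p.T) := by
    intro k t h1 h2
    simp only [x, floor_div_eq hT h1 h2]
  have hxs : ∀ k : ℕ, x (k * p.T) = (st k).1 := by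
    intro k
    rw [hxk k _ le_rfl (by nlinarith), sub_self, hΦ0]
  -- Consistency: decoding the glued curve reproduces the values with which it was built.
  have hdec : ∀ k, decodedStack c p x k = (st k).2 := by
    intro k
    induction k with
    | zero =>
      have h0 := hxs 0
      ext1 i
      show scaling c p 0 • quantizeVec p.L ((scaling c p 0)⁻¹ • x ((0 : ℕ) * p.T) i) = _
      rw [h0]
      rfl
    | succ k ih =>
      have h1 := hxs (k + 1)
      ext1 i
      have h2 : decode p.L (scaling c p) (fun m => x (m * p.T) i) k = (st k).2 i :=
        congrArg (fun v : Stack d => v i) ih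
      show decode p.L (scaling c p) (fun m => x (m * p.T) i) k + scaling c p (k + 1) •
        quantizeVec p.L ((scaling c p (k + 1))⁻¹ • (x ((k + 1 : ℕ) * p.T) i -
          decode p.L (scaling c p) (fun m => x (m * p.T) i) k)) = _
      rw [h2, h1, hst2]
      rfl
  have hIcc : ∀ k : ℕ, ∀ t ∈ Set.Icc (k * p.T) ((k + 1) * p.T),
      x t = Φ (st k).2 (st k).1 (t - k * p.T) := by
    intro k t ht
    rcases ht.2.lt_or_eq with h | h
    · exact hxk k t ht.1 h
    · have h1 := hxs (k + 1)
      push_cast at h1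
      rw [h, h1, hst1]
      congr 1
      ring
  refine ⟨x, ⟨continuousOn_Ici_of_continuousOn_Icc hT fun k => ?_, fun t ht => ?_⟩, ?_⟩
  · have h1 : ContinuousOn (Φ (st k).2 (st k).1) (Set.Icc 0 p.T) := fun t ht =>
      (hΦ _ _ t ht).continuousWithinAt
    have h2 : ContinuousOn (fun t => Φ (st k).2 (st k).1 (t - k * p.T))
        (Set.Icc (k * p.T) ((k + 1) * p.T)) := by
      refine h1.comp (by fun_prop) fun t ht => ?_
      exact ⟨by linarith [ht.1], by linarith [ht.2]⟩
    exact h2.congr (hIcc k)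
  · obtain ⟨h1, h2⟩ := exists_mem_sampling_interval hT ht
    set k := ⌊t / p.T⌋₊ with hk
    rw [velocity_eq, ← hk, hdec, hxk k t h1 h2]
    have h3 := (hΦ (st k).2 (st k).1 (t - k * p.T) ⟨by linarith, by linarith⟩)
    have h4 : HasDerivWithinAt (fun t => Φ (st k).2 (st k).1 (t - k * p.T))
        (-((p.α • W.lap d) (st k).2) - p.ε • gradStack J (Φ (st k).2 (st k).1 (t - k * p.T)))
        (Set.Icc (k * p.T) ((k + 1) * p.T)) t := by
      have hmaps : Set.MapsTo (fun s => s - k * p.T) (Set.Icc (k * p.T) ((k + 1) * p.T))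
          (Set.Icc 0 p.T) := fun s hs => ⟨by linarith [hs.1], by linarith [hs.2]⟩
      exact (h3.scomp t ((hasDerivWithinAt_id t _).sub_const (k * p.T)) hmaps).congr_deriv
        (one_smul _ _)
    -- The half-open period is a right neighbourhood of each of its points, including the sampling
    -- instant; hence right derivatives suffice.
    have h5 : Set.Ico (k * p.T) ((k + 1) * p.T) ∈ 𝓝[≥] t := by
      filter_upwards [self_mem_nhdsWithin, mem_nhdsWithin_of_mem_nhds (Iio_mem_nhds h2)] with
        s hs1 hs2
      exact ⟨h1.trans hs1, hs2⟩
    refine (h4.mono_of_mem_nhdsWithin (mem_of_superset h5 Set.Ico_subset_Icc_self)).congr_of_eventuallyEq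
      ?_ (hxk k t h1 h2)
    exact mem_of_superset h5 fun s hs => hxk k s hs.1 hs.2
  · have h0 := hxs 0
    rw [Nat.cast_zero, zero_mul] at h0
    exact h0

/-! ### Bandwidth of a design -/

/-- The message at time 0 adds r/t, which vanishes in the limit. -/
theorem limsup_message_rate {T : ℝ} (hT : 0 < T) (r : ℝ) :
    limsup (fun t : ℝ => 1 / t * ∑ _k ∈ Finset.range (⌊t / T⌋₊ + 1), r) atTop = r / T := by
  have h1 : Tendsto (fun t : ℝ => (⌊T⁻¹ * t⌋₊ : ℝ) / t) atTop (𝓝 T⁻¹) :=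
    tendsto_nat_floor_mul_div_atTop (by positivity)
  have h2 : Tendsto (fun t : ℝ => ((⌊T⁻¹ * t⌋₊ : ℝ) / t + t⁻¹) * r) atTop (𝓝 ((T⁻¹ + 0) * r)) :=
    (h1.add tendsto_inv_atTop_zero).mul_const r
  have h3 : Tendsto (fun t : ℝ => 1 / t * ∑ _k ∈ Finset.range (⌊t / T⌋₊ + 1), r) atTop
      (𝓝 (r / T)) := by
    rw [show r / T = (T⁻¹ + 0) * r by rw [add_zero]; ring]
    refine h2.congr fun t => ?_
    rw [Finset.sum_const, Finset.card_range, nsmul_eq_mul, inv_mul_eq_div]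
    push_cast
    ring
  exact h3.limsup_eq

theorem designBandwidth_nonneg (W : CommGraph N) {c : Consts} {p : Design} (hT : 0 < p.T) :
    0 ≤ designBandwidth W c p := by
  refine Real.iSup_nonneg fun e => ?_
  rw [limsup_message_rate hT]
  have : 0 ≤ Real.logb 2 (2 * (p.L : ℝ) + 1) :=
    Real.logb_nonneg one_lt_two (by linarith [(Nat.cast_nonneg p.L : (0 : ℝ) ≤ p.L)])
  positivity

theorem designBandwidth_le (W : CommGraph N) {c : Consts} {p : Design} (hT : 0 < p.T) :
    designBandwidth W c p ≤ c.n * Real.logb 2 (2 * (p.L : ℝ) + 1) / p.T := by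
  have : 0 ≤ Real.logb 2 (2 * (p.L : ℝ) + 1) :=
    Real.logb_nonneg one_lt_two (by linarith [(Nat.cast_nonneg p.L : (0 : ℝ) ≤ p.L)])
  refine Real.iSup_le (fun e => ?_) (by positivity)
  rw [limsup_message_rate hT]

/-! ### Choice of the parameters -/

theorem ascEig_congr {m : ℕ} {A B : Matrix (Fin m) (Fin m) ℝ} (h : A = B) (hA : A.IsHermitian)
    (hB : B.IsHermitian) (k : Fin m) : ascEig hA k = ascEig hB k := by
  subst h
  rfl

/-- The number `ν` only depends on the ratio `α / ε`. -/
theorem exists_nu_eq (hN : 0 < N) {μ θ l κ : ℝ} (hμ : 0 < μ) (hκ : θ ^ 2 / μ + θ < κ * l) :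
    ∃ ν : ℝ, 0 < ν ∧ ∀ (c : Consts) (p : Design), c.N = N → c.μ = μ → c.θ = θ → c.lam2 = l →
      p.ε ≠ 0 → p.α = κ * p.ε → nu c p = ν := by
  have hNR : (0 : ℝ) < N := by exact_mod_cast hN
  have hA : (!![μ / N, -(θ / Real.sqrt N); -(θ / Real.sqrt N), κ * l - θ] :
      Matrix (Fin 2) (Fin 2) ℝ).PosDef := by
    -- The gain condition is exactly positivity of the determinant.
    refine posDef_of_det_pos (by positivity) ?_
    rw [neg_sq, div_pow, Real.sq_sqrt hNR.le, div_mul_eq_mul_div]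
    have : θ ^ 2 < μ * (κ * l - θ) := by
      rw [mul_comm, ← div_lt_iff₀ hμ]; linarith
    gcongr
  refine ⟨2 * ascEig hA.isHermitian 0, mul_pos two_pos (ascEig_pos hA 0), ?_⟩
  intro c p h1 h2 h3 h4 h5 h6
  rw [nu, ascEig_congr (B := !![μ / N, -(θ / Real.sqrt N); -(θ / Real.sqrt N), κ * l - θ])]
  rw [rateMatrix, h1, h2, h3, h4, h6, mul_right_comm, mul_div_cancel_right₀ _ h5]

theorem exp_sub_one_le_two_mul {x : ℝ} (h0 : 0 ≤ x) (h1 : x ≤ 1) : Real.exp x - 1 ≤ 2 * x := by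
  have := Real.abs_exp_sub_one_le (x := x) (by rwa [abs_of_nonneg h0])
  rw [abs_of_nonneg h0] at this
  exact (le_abs_self _).trans this

set_option maxHeartbeats 1600000 in
/-- Admissible designs of every rate with one number of quantization levels and with a sampling
period of order `1 / (γ + 1)`, for which the bounds of `norm_sub_le_of_isSolution` are met. -/
theorem exists_uniform_design (hN : 0 < N) (n : ℕ) {l lN μ θ Θ κ Λ : ℝ} (hl : 0 < l) (hlN : 0 < lN)
    (hμ : 0 < μ) (hθ : 0 ≤ θ) (hΘ : 0 ≤ Θ) (hκ0 : 0 < κ) (hΛ : lN ≤ Λ)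
    (hκ : θ ^ 2 / μ + θ < κ * l) :
    ∃ (L : ℕ) (τ : ℝ), 0 < τ ∧ ∀ c : Consts, c.N = N → c.n = n → c.lam2 = l → c.lamN = lN →
      c.μ = μ → c.θ = θ → 0 < c.M0 → ∀ γ : ℝ, 0 < γ → ∃ p : Design, Admissible c p ∧
        rate c p = γ ∧ p.T = τ / (γ + 1) ∧ p.L = L ∧ p.α = κ * p.ε ∧
        2 * γ ≤ p.ε * (μ / (4 * N)) ∧ p.ε * Θ * p.T ≤ 1 / 4 ∧ 0 < s0 c p ∧
        c.M0 ≤ s0 c p * L ∧ ∃ Y E : ℝ, Y = (Real.sqrt (N * n) + 1) * c.M0 ∧ 0 < Y ∧ 0 ≤ E ∧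
          (E / 8 + 2 * (κ * p.ε * Λ * (Y + E / 8) + p.ε * Θ * Y) * p.T) * Real.exp (γ * p.T) ≤ E ∧
          κ * p.ε * Λ * E < γ * Y ∧ Real.sqrt (N * n) * s0 c p / 2 ≤ E / 8 ∧ E ≤ s0 c p * L := by
  obtain ⟨ν, hν, hnu⟩ := exists_nu_eq hN hμ hκ
  have hNR : (0 : ℝ) < N := by exact_mod_cast hN
  have hΛ0 : 0 < Λ := hlN.trans_le hΛ
  -- Chosen so that νβ ≤ μ/(2N): then 2γ = ενβ/2 is at most the available coercivity εμ/(4N).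
  obtain ⟨β, hβ⟩ : ∃ β, β = μ / (2 * N * ν + μ) := ⟨_, rfl⟩
  have hβ0 : 0 < β := by rw [hβ]; positivity
  have hβ1 : β < 1 := by
    rw [hβ, div_lt_one (by positivity)]
    have : 0 < 2 * N * ν := by positivity
    linarith
  have hνβ : ν * β ≤ μ / (2 * N) := by
    rw [hβ, ← mul_div_assoc, div_le_div_iff₀ (by positivity) (by positivity)]
    linarith [mul_pos hμ hμ]
  obtain ⟨σ, hσ⟩ : ∃ σ, σ = Real.sqrt (1 - β) := ⟨_, rfl⟩
  have hσ0 : 0 < σ := by rw [hσ]; exact Real.sqrt_pos.2 (by linarith)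
  have hσ1 : σ ≤ 1 := by rw [hσ]; exact Real.sqrt_le_one.2 (by linarith)
  -- Makes S at most e/4, so that a fresh decoding error is at most E/8.
  obtain ⟨a2, ha2⟩ : ∃ a2, a2 = β * lN / (32 * Λ) := ⟨_, rfl⟩
  have ha20 : 0 < a2 := by rw [ha2]; positivity
  have ha21 : a2 < 1 - 1 / 4 := by
    have h1 : β * lN ≤ 1 * Λ := by gcongr
    rw [ha2, div_lt_iff₀ (by positivity)]
    linarith
  obtain ⟨χ, hχ⟩ : ∃ χ, χ = 4 / (ν * β) := ⟨_, rfl⟩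
  have hχ0 : 0 < χ := by rw [hχ]; positivity
  have hχν : χ * ν * β = 4 := by rw [hχ]; field_simp
  -- The value of ρ, in which ε cancels because α = κε.
  obtain ⟨R, hR⟩ : ∃ R, R = (θ / (κ * lN) + 1) * (8 * κ * lN / (ν ^ 2 * β * σ)) := ⟨_, rfl⟩
  have hR0 : 0 < R := by rw [hR]; positivity
  -- The ratio E/Y; with it the held error costs κεΛE = γY/2, half of the margin.
  obtain ⟨e, he⟩ : ∃ e, e = ν * β / (8 * κ * Λ) := ⟨_, rfl⟩
  have he0 : 0 < e := by rw [he]; positivity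
  obtain ⟨S, hS⟩ : ∃ S, S = a2 * ν * σ / (κ * lN) := ⟨_, rfl⟩
  have hS0 : 0 < S := by rw [hS]; positivity
  have hSe : S ≤ e / 4 := by
    have : S = e / 4 * σ := by rw [hS, he, ha2]; field_simp; ring
    rw [this]
    exact mul_le_of_le_one_right (by positivity) hσ1
  obtain ⟨G, hG⟩ : ∃ G, G = Real.sqrt (N * n) + 1 := ⟨_, rfl⟩
  have hG0 : 0 < G := by rw [hG]; positivity
  obtain ⟨P, hP⟩ : ∃ P, P = 8 * χ * (κ * Λ * (1 + e) + Θ) / e := ⟨_, rfl⟩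
  have hP0 : 0 < P := by rw [hP]; positivity
  -- The summands secure, in order: e^{γT} ≤ 2; αλ_N T ≤ 1; the period rule with a₁ = 1/4; εΘT ≤
  -- 1/4; and a drift within one period of at most E/4.
  obtain ⟨τ, hτ⟩ : ∃ τ, τ = 1 / (2 + κ * lN * χ + 16 * κ * lN * R + 4 * χ * Θ + P) := ⟨_, rfl⟩
  have hτ0 : 0 < τ := by rw [hτ]; positivity
  have hτsum : τ * 2 + τ * (κ * lN * χ) + τ * (16 * κ * lN * R) + τ * (4 * χ * Θ) + τ * P = 1 := by
    have : 0 < 2 + κ * lN * χ + 16 * κ * lN * R + 4 * χ * Θ + P := by positivity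
    rw [hτ]
    field_simp
  have p1 : 0 ≤ τ * (κ * lN * χ) := by positivity
  have p2 : 0 ≤ τ * (16 * κ * lN * R) := by positivity
  have p3 : 0 ≤ τ * (4 * χ * Θ) := by positivity
  have p4 : 0 ≤ τ * P := by positivity
  have t1 : τ ≤ 1 / 2 := by linarith
  have t2 : τ * (κ * lN * χ) ≤ 1 := by linarith
  have t3 : τ * (16 * κ * lN * R) ≤ 1 := by linarith
  have t4 : τ * (4 * χ * Θ) ≤ 1 := by linarith
  have t5 : τ * P ≤ 1 := by linarith
  obtain ⟨X, hX⟩ : ∃ X, X = Real.exp 2 := ⟨_, rfl⟩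
  have hX0 : 0 < X := by rw [hX]; positivity
  -- Three demands added: covering M₀, covering the prediction error E, and the rounding rule; X
  -- bounds every exponential factor. The final 1 makes L positive.
  obtain ⟨L, hL⟩ : ∃ L : ℕ, L = ⌈X / S + e * G * X / S + Real.sqrt (N * n) * X / (2 * a2)⌉₊ + 1 :=
    ⟨_, rfl⟩
  have hLr : X / S + e * G * X / S + Real.sqrt (N * n) * X / (2 * a2) ≤ L := by
    rw [hL]; push_cast
    linarith [Nat.le_ceil (X / S + e * G * X / S + Real.sqrt (N * n) * X / (2 * a2))]
  have q1 : 0 ≤ X / S := by positivity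
  have q2 : 0 ≤ e * G * X / S := by positivity
  have q3 : 0 ≤ Real.sqrt (N * n) * X / (2 * a2) := by positivity
  refine ⟨L, τ, hτ0, ?_⟩
  intro c c1 c2 c3 c4 c5 c6 hM γ hγ
  obtain ⟨T, hT⟩ : ∃ T, T = τ / (γ + 1) := ⟨_, rfl⟩
  have hT0 : 0 < T := by rw [hT]; positivity
  obtain ⟨ε, hε⟩ : ∃ ε, ε = χ * γ := ⟨_, rfl⟩
  have hε0 : 0 < ε := by rw [hε]; positivity
  set p : Design := ⟨ε, κ * ε, β, 1 / 4, a2, T, L⟩ with hp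
  have hnup : nu c p = ν := hnu c p c1 c5 c6 c3 hε0.ne' rfl
  have hrate : rate c p = γ := by
    rw [rate, hnup]
    show ε * ν * β / 4 = γ
    rw [hε]
    linear_combination γ / 4 * hχν
  obtain ⟨u, hu⟩ : ∃ u, u = γ * T := ⟨_, rfl⟩
  have hu0 : 0 < u := by rw [hu]; positivity
  have huτ : u ≤ τ := by
    rw [hu, hT, ← mul_div_assoc, div_le_iff₀ (by positivity)]
    linarith
  -- The period rule divides by ε = χγ, so it needs (γT)² of order γ even for small γ. This is why T
  -- is τ/(γ+1) and not τ/γ, and it is the origin of the constant term in the bandwidth.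
  have hu2 : u ^ 2 ≤ τ * γ := by
    have h1 : T ≤ τ := by rw [hT]; exact div_le_self hτ0.le (by linarith)
    calc u ^ 2 = u * T * γ := by rw [hu]; ring
      _ ≤ 1 * τ * γ := by gcongr; linarith
      _ = τ * γ := by ring
  have hεT : ε * T = χ * u := by rw [hε, hu]; ring
  have hαT : κ * ε * lN * T = κ * lN * χ * u := by linear_combination κ * lN * hεT
  have hχu : κ * lN * χ * u ≤ 1 := by
    rw [mul_comm]
    exact le_trans (by gcongr) t2
  have hexpX : Real.exp (u + κ * lN * χ * u) ≤ X := by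
    rw [hX]; exact Real.exp_le_exp.2 (by linarith)
  have hrho : rho c p = R := by
    rw [rho, hnup, c4, c6, hR]
    show (θ * ε / (κ * ε * lN) + 1) * (8 * (κ * ε) * lN / (ν ^ 2 * β * ε * Real.sqrt (1 - β))) = _
    rw [← hσ]
    field_simp
  have hs0 : s0 c p = S * c.M0 / Real.exp (u + κ * lN * χ * u) := by
    rw [s0, hnup, hrate, c4, hS]
    show a2 * ε * ν * c.M0 / (κ * ε * lN) * Real.sqrt (1 - β) *
      Real.exp (-γ * T - κ * ε * lN * T) = _
    rw [hαT, show -γ * T - κ * lN * χ * u = -(u + κ * lN * χ * u) by rw [hu]; ring, Real.exp_neg,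
      ← hσ]
    field_simp
  have hs0pos : 0 < s0 c p := by rw [hs0]; positivity
  have hs0le : s0 c p ≤ S * c.M0 := by
    rw [hs0]
    exact div_le_self (by positivity) (Real.one_le_exp (by positivity))
  have hs0ge : S * c.M0 / X ≤ s0 c p := by
    rw [hs0]; gcongr
  have hLS : ∀ b, 0 ≤ b → b * X / S ≤ L → b * c.M0 ≤ s0 c p * L := by
    intro b hb hbL
    calc b * c.M0 = S * c.M0 / X * (b * X / S) := by field_simp
      _ ≤ s0 c p * L := by gcongr
  have hM0 : c.M0 ≤ s0 c p * L := by
    have := hLS 1 zero_le_one (by rw [one_mul]; linarith)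
    rwa [one_mul] at this
  have hexpu : Real.exp u ≤ 2 := by
    have := exp_sub_one_le_two_mul hu0.le (by linarith)
    linarith
  refine ⟨p, ?_, hrate, hT, rfl, rfl, ?_, ?_, hs0pos, hM0, G * c.M0, e * (G * c.M0), by rw [hG],
    by positivity, by positivity, ?_, ?_, ?_, ?_⟩
  · refine ⟨hε0, ?_, hβ0, hβ1, by norm_num [hp], by norm_num [hp], ha20, ha21, hT0, ?_, ?_, ?_, ?_⟩
    · rw [c3, c6, c5]
      show ε / l * (θ ^ 2 / μ + θ) < κ * ε
      rw [div_mul_eq_mul_div, div_lt_iff₀ hl]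
      have := mul_lt_mul_of_pos_left hκ hε0
      linarith
    · rw [hrate, hrho, c4]
      show (Real.exp (κ * ε * lN * T) - 1) * (Real.exp (γ * T) - 1) * R * ε⁻¹ ≤ 1 / 4
      rw [hαT, ← hu, ← div_eq_mul_inv, div_le_iff₀ hε0]
      have h1 := exp_sub_one_le_two_mul (x := κ * lN * χ * u) (by positivity) hχu
      have h2 := exp_sub_one_le_two_mul hu0.le (by linarith)
      have h3 : 0 ≤ Real.exp u - 1 := by linarith [Real.one_le_exp hu0.le]
      calc (Real.exp (κ * lN * χ * u) - 1) * (Real.exp u - 1) * R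
          ≤ (2 * (κ * lN * χ * u)) * (2 * u) * R := by gcongr
        _ = 4 * κ * lN * χ * R * u ^ 2 := by ring
        _ ≤ 4 * κ * lN * χ * R * (τ * γ) := by gcongr
        _ = χ * γ / 4 * (τ * (16 * κ * lN * R)) := by ring
        _ ≤ χ * γ / 4 * 1 := by gcongr
        _ = 1 / 4 * ε := by rw [hε]; ring
    · show 0 < L
      omega
    · rw [div_le_iff₀ hs0pos, mul_comm]
      exact hM0
    · rw [Int.ceil_le, hrate, c1, c2, c4]
      show Real.sqrt (N * n) * Real.exp (γ * T + κ * ε * lN * T) / (2 * a2) - 1 / 2 ≤ ((L : ℤ) : ℝ)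
      rw [hαT, ← hu, Int.cast_natCast]
      have : Real.sqrt (N * n) * Real.exp (u + κ * lN * χ * u) / (2 * a2) ≤
        Real.sqrt (N * n) * X / (2 * a2) := by gcongr
      linarith
  · show 2 * γ ≤ ε * (μ / (4 * N))
    have h1 : 2 * γ = ε * (ν * β / 2) := by rw [hε]; linear_combination (-γ / 2) * hχν
    rw [h1]
    have h2 : μ / (4 * N) = μ / (2 * N) / 2 := by field_simp; norm_num
    rw [h2]
    gcongr
  · show ε * Θ * T ≤ 1 / 4
    have h1 : ε * Θ * T = χ * Θ * u := by linear_combination Θ * hεT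
    have h2 : χ * Θ * u ≤ χ * Θ * τ := by gcongr
    linarith
  · show (e * (G * c.M0) / 8 + 2 * (κ * ε * Λ * (G * c.M0 + e * (G * c.M0) / 8) +
      ε * Θ * (G * c.M0)) * T) * Real.exp (γ * T) ≤ e * (G * c.M0)
    rw [← hu]
    have hPe : P * e = 8 * χ * (κ * Λ * (1 + e) + Θ) := by rw [hP]; field_simp
    have h1 : (κ * ε * Λ * (G * c.M0 + e * (G * c.M0) / 8) + ε * Θ * (G * c.M0)) * T =
        χ * (κ * Λ * (1 + e / 8) + Θ) * u * (G * c.M0) := by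
      linear_combination (κ * Λ * (1 + e / 8) + Θ) * (G * c.M0) * hεT
    have h2 : χ * (κ * Λ * (1 + e / 8) + Θ) * u * (G * c.M0) ≤ e / 8 * (G * c.M0) := by
      have h3 : χ * (κ * Λ * (1 + e / 8) + Θ) * u ≤ χ * (κ * Λ * (1 + e) + Θ) * τ := by
        gcongr
        linarith
      have h4 : χ * (κ * Λ * (1 + e) + Θ) * τ = τ * P * (e / 8) := by
        linear_combination (-τ / 8) * hPe
      have h5 : τ * P * (e / 8) ≤ 1 * (e / 8) := by gcongr
      gcongr
      linarith
    have h6 : 0 < e * (G * c.M0) := by positivity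
    -- Decoding error E/8 plus drift E/4, times e^{γT} ≤ 2, stays below E.
    calc _ ≤ (e * (G * c.M0) * (3 / 8)) * 2 := by
          refine mul_le_mul ?_ hexpu (Real.exp_pos _).le (by positivity)
          rw [mul_assoc 2, h1]
          linarith
      _ ≤ _ := by linarith
  · show κ * ε * Λ * (e * (G * c.M0)) < γ * (G * c.M0)
    have h1 : κ * ε * Λ * (e * (G * c.M0)) = γ / 2 * (G * c.M0) := by
      have h2 : e * (8 * κ * Λ) = ν * β := by rw [he]; field_simp
      rw [hε]
      linear_combination (χ * γ * G * c.M0 / 8) * h2 + (γ * G * c.M0 / 8) * hχν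
    rw [h1]
    have : 0 < G * c.M0 := by positivity
    exact mul_lt_mul_of_pos_right (by linarith) this
  · have h1 : Real.sqrt (N * n) ≤ G := by rw [hG]; linarith
    calc Real.sqrt (N * n) * s0 c p / 2 ≤ G * (e / 4 * c.M0) / 2 := by
          gcongr
          exact hs0le.trans (by gcongr)
      _ = _ := by ring
  · rw [← mul_assoc]
    exact hLS (e * G) (by positivity) (by linarith)

theorem norm_le_of_supBound {v : Stack d} {b : ℝ} (hb : 0 ≤ b) (hv : ∀ i, SupBound (v i) b) :
    ‖v‖ ≤ Real.sqrt (N * (∑ i, d i : ℕ)) * b := by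
  refine le_of_sq_le_sq ?_ (by positivity)
  rw [PiLp.norm_sq_eq_of_L2, mul_pow, Real.sq_sqrt (by positivity)]
  have h1 : ∀ i ∈ Finset.univ, ‖v i‖ ^ 2 ≤ (∑ i, d i : ℕ) * b ^ 2 := by
    intro i _
    rw [PiLp.norm_sq_eq_of_L2]
    have h2 : ∀ j ∈ Finset.univ, ‖v i j‖ ^ 2 ≤ d j * b ^ 2 := by
      intro j _
      rw [EuclideanSpace.norm_sq_eq]
      have h3 : ∀ k ∈ Finset.univ, ‖v i j k‖ ^ 2 ≤ b ^ 2 := fun k _ =>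
        pow_le_pow_left₀ (norm_nonneg _) (hv i j k) 2
      simpa using Finset.sum_le_sum h3
    refine (Finset.sum_le_sum h2).trans (le_of_eq ?_)
    rw [← Finset.sum_mul]
    push_cast
    rfl
  refine (Finset.sum_le_sum h1).trans (le_of_eq ?_)
  simp
  ring

end QuantizedNash

end

/-! ### Proof of the theorem -/

open QuantizedNash
theorem theorem3 {N : ℕ} (hN : 2 ≤ N) (W : CommGraph N) (hW : W.graph.Connected)
    (d : Fin N → ℕ) (J : Fin N → Profile d → ℝ) (μ : ℝ) (θown θother : Fin N → ℝ)
    (hJ : RegularCosts J) (hF : MonotoneLipschitz J μ θown θother) :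
    ∃ c₁ c₂ : ℝ, 0 < c₁ ∧ 0 < c₂ ∧
      ∀ M M' : ℝ, 0 < M + M' → (∀ xs : Profile d, IsNash J xs → SupBound xs M') →
        ∀ γ : ℝ, 0 < γ →
          (∃ B ∈ sufficientBandwidths W J (consts W hN d μ θown θother M M') M γ,
            B ≤ c₁ * γ + c₂) ∧
          minBandwidth W J (consts W hN d μ θown θother M M') M γ ≤ c₁ * γ + c₂ := by
  have hN0 : 0 < N := by omega
  have hμ := hF.mu_pos
  set Θ := ∑ j, (θown j + θother j) with hΘdef
  have hΘ : 0 ≤ Θ := Finset.sum_nonneg fun j _ => add_nonneg (hF.own_nonneg j) (hF.other_nonneg j)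
  have hθ : 0 ≤ theta θown θother := Real.iSup_nonneg fun i => Real.sqrt_nonneg _
  have hl := W.lam2_pos hN hW
  have hlN := W.lamN_pos hN hW
  obtain ⟨κ₀, hκ₀, hcoer⟩ := hF.exists_augmented_coercive W hW hN0
  set θ := theta θown θother with hθdef
  obtain ⟨κ, hκ1, hκ2⟩ : ∃ κ, κ₀ ≤ κ ∧ θ ^ 2 / μ + θ < κ * W.lam2 hN := by
    refine ⟨max κ₀ ((θ ^ 2 / μ + θ) / W.lam2 hN + 1), le_max_left _ _, ?_⟩
    rw [← div_lt_iff₀ hl]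
    exact lt_of_lt_of_le (lt_add_one _) (le_max_right _ _)
  have hκ0 : 0 < κ := hκ₀.trans_le hκ1
  -- An upper bound for both the operator norm on stacks and λ_N, so the two need not be identified.
  set Λ := ‖W.lap d‖ + W.lamN hN with hΛ
  obtain ⟨L, τ, hτ, hdes⟩ := exists_uniform_design hN0 (∑ i, d i) hl hlN hμ hθ hΘ hκ0
    (Λ := Λ) (by rw [hΛ]; linarith [norm_nonneg (W.lap d)]) hκ2
  have hΛ0 : 0 < Λ := by positivity
  obtain ⟨xs, hxs⟩ := hF.exists_gameMap_eq_zero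
  have hnash := isNash_of_gameMap_eq_zero hJ hxs
  set r := ((∑ i, d i : ℕ) : ℝ) * Real.logb 2 (2 * (L : ℝ) + 1) with hr
  have hr0 : 0 ≤ r := mul_nonneg (Nat.cast_nonneg _)
    (Real.logb_nonneg one_lt_two (by linarith [(Nat.cast_nonneg L : (0 : ℝ) ≤ L)]))
  -- The added 1 keeps the constants positive when n = 0.
  refine ⟨r / τ + 1, r / τ + 1, by positivity, by positivity, ?_⟩
  intro M M' hM hM' γ hγ
  set c := consts W hN d μ θown θother M M' with hc
  obtain ⟨p, hadm, hrate, hpT, hpL, hpα, h2γ, hKT, hs, hM0, Y, E, hYdef, hY, hE0, hE, hEY, hq, hEL⟩ :=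
    hdes c rfl rfl rfl rfl rfl rfl hM γ hγ
  have hT := hadm.period_pos
  have hε := hadm.eps_pos
  have hcM : c.M0 = M + M' := rfl
  have hgrad : ∀ v w : Stack d, ‖p.ε • gradStack J v - p.ε • gradStack J w‖ ≤
      p.ε * Θ * ‖v - w‖ := by
    intro v w
    rw [← smul_sub, norm_smul, Real.norm_of_nonneg hε.le, mul_assoc]
    exact mul_le_mul_of_nonneg_left (hF.norm_gradStack_sub_le v w) hε.le
  have hconv : ConvergesToNash W J c p M γ := by
    refine ⟨fun z _ => exists_isSolution (K := ⟨p.ε * Θ, by positivity⟩)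
      (LipschitzWith.of_dist_le_mul fun v w => by
        rw [dist_eq_norm, dist_eq_norm]; exact hgrad v w)
      hT (hKT.trans (by norm_num)) z, xs, hnash, Y, fun x hx hx0 => ?_⟩
    refine norm_sub_le_of_isSolution (K := p.ε * Θ) (Γ := κ * p.ε * Λ) (q := E / 8) (E := E)
      hx hrate hγ hT hs (W.lap_const xs) ?_ ?_ ?_ (by positivity) (by positivity) hY (by positivity)
      hKT hE hEY hq ?_ ?_ ?_
    · intro v
      have h1 := hcoer κ hκ1 xs hxs v
      rw [smul_apply, real_inner_smul_right, real_inner_smul_right, hpα]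
      calc _ ≤ p.ε * (μ / (4 * N)) * ‖v - WithLp.toLp 2 fun _ => xs‖ ^ 2 := by gcongr
        _ = p.ε * (μ / (4 * N) * ‖v - WithLp.toLp 2 fun _ => xs‖ ^ 2) := by ring
        _ ≤ p.ε * _ := mul_le_mul_of_nonneg_left h1 hε.le
        _ = _ := by ring
    · intro v
      have h1 := hgrad v (WithLp.toLp 2 fun _ => xs)
      rwa [gradStack_const_eq_zero hxs, smul_zero, sub_zero] at h1
    · intro v
      rw [smul_apply, norm_smul, hpα, Real.norm_of_nonneg (by positivity), mul_assoc (κ * p.ε)]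
      have h1 : ‖W.lap d v‖ ≤ Λ * ‖v‖ := ((W.lap d).le_opNorm v).trans (by
        gcongr; rw [hΛ]; linarith)
      gcongr
    · rw [hpL]
      exact hEL.trans (by gcongr; linarith)
    · have h1 := norm_le_of_supBound (v := x 0 - WithLp.toLp 2 fun _ => xs) (b := c.M0) hM.le
        fun i j k => by
          rw [hcM]
          have h2 := hx0 i j k
          have h3 := hM' xs hnash j k
          exact (abs_sub (x 0 i j k) (xs j k)).trans (add_le_add h2 h3)
      refine h1.trans ?_
      rw [hYdef]
      have : 0 < c.M0 := hM
      gcongr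
      linarith
    · intro i j k
      have h2 := hx0 i j k
      -- A coordinate of the equilibrium exists here, so M' ≥ 0 and M ≤ M₀, which the quantizer
      -- range covers.
      have h3 := (abs_nonneg _).trans (hM' xs hnash j k)
      rw [hpL]
      have h4 : s0 c p * L ≤ s0 c p * (L + 1 / 2) := by gcongr; linarith
      linarith
  have hmem : designBandwidth W c p ∈ sufficientBandwidths W J c M γ :=
    ⟨p, hadm, hrate, hconv, rfl⟩
  have hle : designBandwidth W c p ≤ (r / τ + 1) * γ + (r / τ + 1) := by
    refine (designBandwidth_le W hT).trans ?_
    rw [hpL, hpT]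
    have h1 : (c.n : ℝ) * Real.logb 2 (2 * (L : ℝ) + 1) / (τ / (γ + 1)) = r / τ * (γ + 1) := by
      rw [hr]
      change ((∑ i, d i : ℕ) : ℝ) * Real.logb 2 (2 * (L : ℝ) + 1) / (τ / (γ + 1)) = _
      field_simp
    rw [h1]
    linarith
  -- The infimum is a genuine lower bound because all bandwidths are nonnegative.
  refine ⟨⟨_, hmem, hle⟩, (csInf_le ⟨0, ?_⟩ hmem).trans hle⟩
  rintro B ⟨p', hp', -, -, rfl⟩
  exact designBandwidth_nonneg W hp'.period_pos
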